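/- \textbf{Conventions.} A metric simplicial complex is a connected, locally finite simplicial complex whose vertex set carries the path metric of the $1$-skeleton with unit edges; the diameter of a subcomplex is that of its vertex set. It has bounded geometry if the number of simplices in links is uniformly bounded. For a subcomplex $A$, $N_R(A)$ is the $R$-fold iterated closed star of $A$. (Co)chains are simplicial with integer coefficients and are zero in negative degrees; reduced homology $\tilde H_*$ is the homology of the augmented chain complex (so $\tilde H_{-1}(\emptyset)=\mathbb Z$). The support of a set of chains is the smallest subcomplex carrying it, and a homomorphism $h$ of (co)chain groups has displacement $\le d$ if $\mathrm{Support}(h(C_*(\sigma)))\subset N_d(\sigma)$ for every simplex $\sigma$. A function $a$ is an acyclicity function for $X$ in degree $j$ if for every subcomplex $A$ of diameter $\le r$ the map $\tilde H_j(A)\to\tilde H_j(N_{a(r)}(A))$ is zero; $X$ is uniformly acyclic (uniformly $m$-acyclic) if some function is an acyclicity function in all degrees $j\ge 0$ (in all degrees $0\le j\le m$). A coarse $PD(n)$ space is a bounded geometry, uniformly acyclic metric simplicial complex $X$ with chain maps $\bar P:C_*(X)\to C_c^{n-*}(X)$ and $P:C_c^{n-*}(X)\to C_*(X)$ and chain homotopies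 $P\bar P\simeq\mathrm{id}$, $\bar P P\simeq \mathrm{id}$, all four of displacement $\le D_0$ for some constant $D_0$; put $D=D_0+1$. A chain map $f:C_*(X')\to C_*(X)$ preserving augmentations is uniformly proper if $\mathrm{diam}\,\mathrm{Support}(f(C_*(\sigma)))\le L$ for all simplices $\sigma$ and some $L$, and there is a function $\phi:\mathbb R_+\to\mathbb R_+$ with $\phi(r)\to\infty$ as $r\to\infty$ such that $\mathrm{diam}\,\mathrm{Support}(f(C_*(A)))\ge\phi(r)$ for every subcomplex $A$ of diameter $\ge r$. A morphism $f_\bullet$ from an inverse system $(A_R,p)$ to an inverse system $(B_R,q)$ over a cofinal, order preserving, partially defined map $\alpha$ is an $\omega$-approximate monomorphism if for all $R$ one has $\ker(A_{\omega(R)}\to B_{\alpha(\omega(R))})\subset\ker(A_{\omega(R)}\to A_R)$, and an $\omega$-approximate epimorphism if for all $R$ the image of $B_{\omega(R)}\to B_R$ lies in the union of the images of $A_S\to B_{\alpha(S)}\to B_R$ over $\alpha(S)\ge R$. For direct systems the conditions are $\ker(A_R\to B_{\alpha(R)})\subset \ker(A_R\to A_{\omega(R)})$, and that the image of $B_R\to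 B_{\omega(R)}$ lies in the union of the images of $A_S\to B_{\alpha(S)}\to B_{\omega(R)}$ over $\alpha(S)\le\omega(R)$. An $\omega$-approximate isomorphism is both. \textbf{Theorem.} Let $X$ be a coarse $PD(n)$ space, let $k\ge 0$, let $X'$ be a bounded geometry, uniformly $(k-1)$-acyclic metric simplicial complex, and let $f:C_*(X')\to C_*(X)$ be a uniformly proper chain map. Let $K=\mathrm{Support}(f(C_*(X')))$ and let $Y_R=\overline{X-N_R(K)}$. Let $\bar A$ denote the inverse of the (bijective) boundary map of the pair followed by the map induced by $\bar P$: $$\tilde H_{n-i-1}(Y_{R+D})\cong H_{n-i}(X,Y_{R+D})\to H^i_c(N_R(K)),\qquad \tilde H_i(N_R(K))\cong H_{i+1}(X,N_R(K))\to H^{n-i-1}_c(Y_{R+D}).$$ There is a function $\omega:\mathbb N\to\mathbb N$, depending only on $D_0$, on $L$ and $\phi$, on the acyclicity functions of $X$ and $X'$, and on the bounds on the geometry of $X$ and $X'$, such that the following hold (with $i\in\mathbb Z$). 1. The compositions $\tilde H_{n-i-1}(Y_{R+D})\xrightarrow{\bar A}H^i_c(N_R(K))\xrightarrow{H^i_c(f)}H^i_c(X')$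 form a morphism from the inverse system $\{\tilde H_{n-i-1}(Y_R)\}_{R\ge0}$ to the constant inverse system $H^i_c(X')$, which is an $\omega$-approximate isomorphism for $i<k$ and an $\omega$-approximate monomorphism for $i=k$. 2. The compositions $\tilde H_i(X')\to\tilde H_i(N_R(K))\xrightarrow{\bar A}H^{n-i-1}_c(Y_{R+D})$ form a morphism from the constant direct system $\tilde H_i(X')$ to the direct system $\{H^{n-i-1}_c(Y_R)\}_{R\ge0}$, which is an $\omega$-approximate isomorphism for $i<k$ and an $\omega$-approximate epimorphism for $i=k$. 3. There is a function $\zeta:\mathbb N\to\mathbb N$ such that for all $i<k$, all subcomplexes $S\subset X'$ with $T=\mathrm{Support}(f(C_*(S)))$, all $\alpha\in\mathrm{Im}(H^i_c(X',\overline{X'-S})\to H^i_c(X'))$ and all $R\ge D$, the class $\alpha$ belongs to the image of the composition $$\tilde H_{n-i-1}(Y_R\cap N_{\zeta(R)}(T))\to\tilde H_{n-i-1}(Y_R)\to H^i_c(X'),$$ the second map being the one of part 1. 4. If $k=n+1$, then $H^n_c(X')=0$ unless $N_R(K)=X$ for some $R$. -/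

import Mathlib

open scoped ENNReal NNReal
open Filter

universe u v w

set_option linter.unusedSectionVars false

noncomputable section

namespace CoarseAlexander

/-! ### Metric simplicial complexes -/

/-- The 1-skeleton of a simplicial complex, as a graph on the vertex set. -/
def edgeGraph {V : Type u} (X : AbstractSimplicialComplex V) : SimpleGraph V where
  Adj v w := v ≠ w ∧ ∃ s ∈ X.faces, v ∈ s ∧ w ∈ s
  symm := ⟨fun _ _ h => ⟨h.1.symm, h.2.imp fun _ hs => ⟨hs.1, hs.2.2, hs.2.1⟩⟩⟩
  loopless := ⟨fun _ h => h.1 rfl⟩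

/-- A metric simplicial complex: a connected, locally finite simplicial complex with vertex set `V`.
Its vertices are metrized by the path metric of the 1-skeleton, all edges having length one. -/
structure MetricComplex (V : Type u) extends AbstractSimplicialComplex V where
  connected : (edgeGraph toAbstractSimplicialComplex).Connected
  locallyFinite : ∀ v : V, {s ∈ faces | v ∈ s}.Finite

variable {V : Type u} {V' : Type v} [LinearOrder V] [LinearOrder V']

/-- The (nonempty) simplices of `X`, ordered by inclusion. -/
abbrev Simplex (X : MetricComplex V) : Type u := {s : Finset V // s ∈ X.faces}

/-- Subcomplexes of `X`: sets of simplices closed under passing to faces. -/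
abbrev Subcomplex (X : MetricComplex V) : Type u := LowerSet (Simplex X)

namespace MetricComplex

/-- The combinatorial distance of vertices. -/
def dist (X : MetricComplex V) (v w : V) : ℕ :=
  (edgeGraph X.toAbstractSimplicialComplex).dist v w

/-- All links have at most `N` simplices. -/
def BoundedGeometry (X : MetricComplex V) (N : ℕ) : Prop :=
  ∀ s : Simplex X, {t : Simplex X | Disjoint s.1 t.1 ∧ s.1 ∪ t.1 ∈ X.faces}.encard ≤ N

end MetricComplex

variable {X : MetricComplex V} {X' : MetricComplex V'}

/-- The vertices of a subcomplex. -/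
def verts (A : Subcomplex X) : Set V := {v | ∃ s ∈ A, v ∈ s.1}

/-- The diameter of a subcomplex: the diameter of its zero-skeleton. -/
def ediam (A : Subcomplex X) : ℝ≥0∞ :=
  ⨆ v ∈ verts A, ⨆ w ∈ verts A, (X.dist v w : ℝ≥0∞)

/-- The closed star: the union of the closed simplices that meet `A`. -/
def closedStar (A : Subcomplex X) : Subcomplex X := lowerClosure {t | ∃ v ∈ t.1, v ∈ verts A}

/-- The combinatorial `r`-tubular neighbourhood: the `r`-fold iterated closed star. -/
def nbhd (r : ℕ) (A : Subcomplex X) : Subcomplex X := closedStar^[r] A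

/-- The closure of the complement of a subcomplex. -/
def coComplement (A : Subcomplex X) : Subcomplex X := lowerClosure {t | t ∉ A}

/-! ### Simplicial chains and compactly supported cochains

Simplices are oriented by the order of the vertices. -/

/-- The group `⨁ⱼ Cⱼ(X)` of simplicial chains. -/
abbrev Chains (X : MetricComplex V) : Type u := Simplex X →₀ ℤ

/-- The group `⨁ⱼ Cⱼ_c(X)` of compactly supported simplicial cochains, i.e. of finitely supported
functions on the simplices. -/
abbrev Cochains (X : MetricComplex V) : Type u := Simplex X →₀ ℤ

/-- The (co)chains of `X` which vanish off the set `A` of simplices. -/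
def chainsIn (A : Set (Simplex X)) : Submodule ℤ (Simplex X →₀ ℤ) := Finsupp.supported ℤ ℤ A

/-- The (co)chains of degree `j` which vanish off the set `A` of simplices
(only zero when `j` is negative). -/
def chainsOn (A : Set (Simplex X)) (j : ℤ) : Submodule ℤ (Simplex X →₀ ℤ) :=
  Finsupp.supported ℤ ℤ {s | s ∈ A ∧ (s.1.card : ℤ) = j + 1}

open Classical in
/-- The simplicial boundary operator (zero on vertices). -/
def boundary (X : MetricComplex V) : Chains X →ₗ[ℤ] Chains X :=
  Finsupp.linearCombination ℤ fun s => ∑ v ∈ s.1,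
    if h : s.1.erase v ∈ X.faces then
      Finsupp.single ⟨s.1.erase v, h⟩ ((-1) ^ (s.1.filter (· < v)).card) else 0

/-- The usual augmentation: the sum of the coefficients of the vertices. -/
def augmentation (X : MetricComplex V) : Chains X →ₗ[ℤ] ℤ :=
  Finsupp.linearCombination ℤ fun s => if s.1.card = 1 then 1 else 0

/-- The boundary operator of the augmented chain complex. The second factor of `Chains X × ℤ` is the
term of degree `-1`, onto which the vertices are mapped by the augmentation. -/
def augBoundary (X : MetricComplex V) : Chains X × ℤ →ₗ[ℤ] Chains X × ℤ :=
  ((boundary X).prod (augmentation X)) ∘ₗ LinearMap.fst ℤ (Chains X) ℤ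

/-- The chains of degree `j` of the augmented chain complex of `A`. -/
def augChainsOn (A : Subcomplex X) (j : ℤ) : Submodule ℤ (Chains X × ℤ) :=
  (chainsOn (A : Set (Simplex X)) j).prod (if j = -1 then ⊤ else ⊥)

section BoundarySquared

/-- The boundary operator on the full augmented simplex, spanned by all finite sets. -/
def fullBoundary (V : Type u) [LinearOrder V] : (Finset V →₀ ℤ) →ₗ[ℤ] (Finset V →₀ ℤ) :=
  Finsupp.linearCombination ℤ fun s => ∑ v ∈ s,
    Finsupp.single (s.erase v) ((-1) ^ (s.filter (· < v)).card)

lemma sign_aux (s : Finset V) {v w : V} (hv : v ∈ s) (h : v < w) :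
    ((-1 : ℤ) ^ (s.filter (· < v)).card * (-1) ^ ((s.erase v).filter (· < w)).card)
      = - ((-1) ^ (s.filter (· < w)).card * (-1) ^ ((s.erase w).filter (· < v)).card) := by
  have h1 : (s.erase w).filter (· < v) = s.filter (· < v) := by
    ext x; simp only [Finset.mem_filter, Finset.mem_erase]
    constructor
    · tauto
    · intro hx; exact ⟨⟨(hx.2.trans h).ne, hx.1⟩, hx.2⟩
  have h2 : ((s.erase v).filter (· < w)) = (s.filter (· < w)).erase v := by
    ext x; simp only [Finset.mem_filter, Finset.mem_erase]; tauto
  have h3 : v ∈ s.filter (· < w) := by simp [hv, h]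
  have h4 := Finset.card_erase_add_one h3
  rw [h1, h2, ← h4, pow_succ]; ring

lemma fullBoundary_comp (c : Finset V →₀ ℤ) : fullBoundary V (fullBoundary V c) = 0 := by
  suffices h : fullBoundary V ∘ₗ fullBoundary V = 0 from LinearMap.congr_fun h c
  ext1 s; ext1
  simp only [LinearMap.comp_apply, LinearMap.zero_apply, Finsupp.lsingle_apply, fullBoundary,
    Finsupp.linearCombination_single, one_smul, map_sum, Finset.smul_sum]
  rw [Finset.sum_sigma' s (fun v => s.erase v)]
  refine Finset.sum_involution (fun p _ => ⟨p.2, p.1⟩) ?_ ?_ ?_ ?_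
  · rintro ⟨v, w⟩ hp
    simp only [Finset.mem_sigma, Finset.mem_erase] at hp
    obtain ⟨hv, hwv, hw⟩ := hp
    simp only [Finsupp.smul_single, smul_eq_mul]
    rw [Finset.erase_right_comm (a := w) (b := v), ← Finsupp.single_add]
    rw [Finsupp.single_eq_zero]
    rcases lt_or_gt_of_ne hwv with h | h
    · rw [sign_aux s hw h]; ring
    · rw [sign_aux s hv h]; ring
  · rintro ⟨v, w⟩ hp _ h
    simp only [Finset.mem_sigma, Finset.mem_erase] at hp
    simp only [Sigma.mk.injEq, heq_eq_eq] at h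
    exact hp.2.1 h.1
  · rintro ⟨v, w⟩ hp
    simp only [Finset.mem_sigma, Finset.mem_erase] at hp ⊢
    exact ⟨hp.2.2, fun h => hp.2.1 h.symm, hp.1⟩
  · rintro ⟨v, w⟩ hp; rfl

/-- The augmented chains of `X` inside those of the full simplex. -/
def toFull (X : MetricComplex V) : Chains X × ℤ →ₗ[ℤ] (Finset V →₀ ℤ) :=
  (Finsupp.lmapDomain ℤ ℤ (Subtype.val : Simplex X → Finset V)).coprod (Finsupp.lsingle ∅)

lemma simplex_nonempty (s : Simplex X) : s.1.Nonempty := (X.isRelLowerSet_faces s.2).1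

lemma toFull_injective (X : MetricComplex V) : Function.Injective (toFull X) := by
  rw [← LinearMap.ker_eq_bot, LinearMap.ker_eq_bot']
  rintro ⟨c, m⟩ h
  simp only [toFull, LinearMap.coprod_apply, Finsupp.lmapDomain_apply, Finsupp.lsingle_apply] at h
  have hm : m = 0 := by
    have := DFunLike.congr_fun h ∅
    rw [Finsupp.add_apply, Finsupp.mapDomain_of_notMem_range] at this
    · simpa using this
    · rintro ⟨s, hs⟩
      exact (simplex_nonempty s).ne_empty hs
  subst hm
  rw [Finsupp.single_zero, add_zero] at h
  have := Finsupp.mapDomain_injective (M := ℤ) (Subtype.val_injective (p := fun s => s ∈ X.faces))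
    (a₁ := c) (a₂ := 0) (by rw [h]; simp)
  simp [this]

lemma toFull_augBoundary (X : MetricComplex V) (c : Chains X × ℤ) :
    toFull X (augBoundary X c) = fullBoundary V (toFull X c) := by
  suffices h : toFull X ∘ₗ augBoundary X = fullBoundary V ∘ₗ toFull X from
    LinearMap.congr_fun h c
  ext1
  · ext1 s; ext1
    simp only [LinearMap.comp_apply, LinearMap.inl_apply, Finsupp.lsingle_apply, augBoundary,
      LinearMap.fst_apply, LinearMap.prod_apply, Function.prod_apply, boundary, augmentation,
      Finsupp.linearCombination_single, one_smul, toFull, LinearMap.coprod_apply,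
      Finsupp.lmapDomain_apply, Finsupp.mapDomain_single, map_zero, add_zero, fullBoundary]
    by_cases hs : s.1.card = 1
    · obtain ⟨v, hv⟩ := Finset.card_eq_one.mp hs
      have : (∅ : Finset V) ∉ X.faces := fun h => by
        simpa using (X.isRelLowerSet_faces h).1
      simp [hv, this, Finset.filter_singleton]
    · have key : ∀ v ∈ s.1, s.1.erase v ∈ X.faces := by
        intro v hv
        refine (X.isRelLowerSet_faces s.2).2 (Finset.erase_subset _ _) ?_
        rw [← Finset.card_pos, Finset.card_erase_of_mem hv]
        have := Finset.card_pos.mpr (simplex_nonempty s)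
        omega
      rw [if_neg hs, Finsupp.single_zero, add_zero, Finsupp.mapDomain_finsetSum]
      refine Finset.sum_congr rfl fun v hv => ?_
      rw [dif_pos (key v hv), Finsupp.mapDomain_single]
  · ext1
    simp [augBoundary, toFull, fullBoundary]

lemma augBoundary_augBoundary (X : MetricComplex V) (c : Chains X × ℤ) :
    augBoundary X (augBoundary X c) = 0 := by
  apply toFull_injective X
  rw [toFull_augBoundary, toFull_augBoundary, fullBoundary_comp, map_zero]

lemma boundary_boundary (X : MetricComplex V) (c : Chains X) : boundary X (boundary X c) = 0 :=
  congrArg Prod.fst (augBoundary_augBoundary X (c, 0))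

lemma augmentation_boundary (X : MetricComplex V) (c : Chains X) :
    augmentation X (boundary X c) = 0 :=
  congrArg Prod.snd (augBoundary_augBoundary X (c, 0))

end BoundarySquared

/-! ### Subquotients, homology and compactly supported cohomology -/

/-- The subquotient `Z / B` (used for submodules `B ≤ Z`). -/
abbrev Subquot {G : Type*} [AddCommGroup G] (Z B : Submodule ℤ G) : Type _ :=
  Z ⧸ B.comap Z.subtype

namespace Subquot

variable {G₁ : Type*} {G₂ : Type*} {G₃ : Type*}
  [AddCommGroup G₁] [AddCommGroup G₂] [AddCommGroup G₃]

/-- The map of subquotients induced by a homomorphism. -/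
def map {Z₁ B₁ : Submodule ℤ G₁} {Z₂ B₂ : Submodule ℤ G₂} (g : G₁ →ₗ[ℤ] G₂)
    (hZ : ∀ z ∈ Z₁, g z ∈ Z₂) (hB : ∀ b ∈ B₁, g b ∈ B₂) : Subquot Z₁ B₁ →+ Subquot Z₂ B₂ :=
  (Submodule.mapQ (B₁.comap Z₁.subtype) (B₂.comap Z₂.subtype) (g.restrict hZ)
    fun z hz => hB z.1 hz).toAddMonoidHom

/-- The class of an element of `Z`. -/
def mk {Z B : Submodule ℤ G₁} (z : G₁) (hz : z ∈ Z) : Subquot Z B := Submodule.Quotient.mk ⟨z, hz⟩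

lemma exists_mk {Z B : Submodule ℤ G₁} (x : Subquot Z B) : ∃ z, ∃ hz : z ∈ Z, x = mk z hz := by
  obtain ⟨⟨z, hz⟩, rfl⟩ := Submodule.Quotient.mk_surjective _ x
  exact ⟨z, hz, rfl⟩

lemma mk_eq_mk {Z B : Submodule ℤ G₁} {z z' : G₁} {hz : z ∈ Z} {hz' : z' ∈ Z} :
    (mk z hz : Subquot Z B) = mk z' hz' ↔ z - z' ∈ B := Submodule.Quotient.eq _

lemma map_mk {Z₁ B₁ : Submodule ℤ G₁} {Z₂ B₂ : Submodule ℤ G₂} (g : G₁ →ₗ[ℤ] G₂)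
    (hZ : ∀ z ∈ Z₁, g z ∈ Z₂) (hB : ∀ b ∈ B₁, g b ∈ B₂) (z : G₁) (hz : z ∈ Z₁) :
    map g hZ hB (mk z hz) = mk (g z) (hZ z hz) := rfl

end Subquot

/-- Reduced cycles of a subcomplex. -/
def redCycles (A : Subcomplex X) (j : ℤ) : Submodule ℤ (Chains X × ℤ) :=
  augChainsOn A j ⊓ LinearMap.ker (augBoundary X)

/-- Reduced boundaries of a subcomplex. -/
def redBoundaries (A : Subcomplex X) (j : ℤ) : Submodule ℤ (Chains X × ℤ) :=
  (augChainsOn A (j + 1)).map (augBoundary X)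

/-- Reduced homology of a subcomplex, i.e. the homology of its augmented chain complex
(so the reduced homology of the empty complex is `ℤ` in degree `-1`). -/
abbrev RedHomology (A : Subcomplex X) (j : ℤ) : Type _ :=
  Subquot (redCycles A j) (redBoundaries A j)

/-- Relative cycles of the pair `(X, A)`. -/
def relCycles (A : Subcomplex X) (j : ℤ) : Submodule ℤ (Chains X) :=
  chainsOn Set.univ j ⊓ (chainsIn (A : Set (Simplex X))).comap (boundary X)

/-- Relative boundaries of the pair `(X, A)`. -/
def relBoundaries (A : Subcomplex X) (j : ℤ) : Submodule ℤ (Chains X) :=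
  (chainsOn Set.univ (j + 1)).map (boundary X) ⊔ chainsOn (A : Set (Simplex X)) j

/-- The homology of the pair `(X, A)`. -/
abbrev RelHomology (A : Subcomplex X) (j : ℤ) : Type _ :=
  Subquot (relCycles A j) (relBoundaries A j)

lemma mem_chainsOn {A : Set (Simplex X)} {j : ℤ} {c : Simplex X →₀ ℤ} :
    c ∈ chainsOn A j ↔ ∀ s, c s ≠ 0 → s ∈ A ∧ (s.1.card : ℤ) = j + 1 := by
  simp only [chainsOn, Finsupp.mem_supported, Set.subset_def, Finset.mem_coe,
    Finsupp.mem_support_iff, Set.mem_ofPred_eq]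

lemma mem_chainsIn {A : Set (Simplex X)} {c : Simplex X →₀ ℤ} :
    c ∈ chainsIn A ↔ ∀ s, c s ≠ 0 → s ∈ A := by
  simp only [chainsIn, Finsupp.mem_supported, Set.subset_def, Finset.mem_coe,
    Finsupp.mem_support_iff]

lemma chainsOn_mono {A B : Set (Simplex X)} (h : A ⊆ B) (j : ℤ) : chainsOn A j ≤ chainsOn B j :=
  fun _ hc => mem_chainsOn.2 fun s hs => ⟨h (mem_chainsOn.1 hc s hs).1, (mem_chainsOn.1 hc s hs).2⟩

lemma augChainsOn_mono {A B : Subcomplex X} (h : A ≤ B) (j : ℤ) :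
    augChainsOn A j ≤ augChainsOn B j :=
  Submodule.prod_mono (chainsOn_mono h j) le_rfl

lemma boundary_single (s : Simplex X) (t : Simplex X) (h : boundary X (Finsupp.single s 1) t ≠ 0) :
    t ≤ s ∧ t.1.card + 1 = s.1.card := by
  classical
  simp only [boundary, Finsupp.linearCombination_single, one_smul, Finsupp.finsetSum_apply] at h
  obtain ⟨v, hv, hne⟩ := Finset.exists_ne_zero_of_sum_ne_zero h
  split_ifs at hne with hf
  · have : t = ⟨s.1.erase v, hf⟩ := by
      by_contra hcon
      exact hne (Finsupp.single_eq_of_ne hcon)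
    subst this
    exact ⟨Finset.erase_subset _ _, Finset.card_erase_add_one hv⟩
  · exact absurd rfl hne

/-- A linear map on finitely supported functions is determined on the support. -/
lemma apply_ne_zero {α β : Type*} (g : (α →₀ ℤ) →ₗ[ℤ] (β →₀ ℤ)) (c : α →₀ ℤ) (t : β)
    (h : g c t ≠ 0) : ∃ s, c s ≠ 0 ∧ g (Finsupp.single s 1) t ≠ 0 := by
  by_contra hcon
  push Not at hcon
  apply h
  conv_lhs => rw [← Finsupp.sum_single c]
  rw [Finsupp.sum, map_sum, Finsupp.finsetSum_apply]
  refine Finset.sum_eq_zero fun s hs => ?_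
  have : Finsupp.single s (c s) = c s • Finsupp.single s (1 : ℤ) := by simp
  rw [this, map_smul, Finsupp.smul_apply, hcon s (Finsupp.mem_support_iff.1 hs), smul_zero]

lemma boundary_mem_chainsOn {A : Subcomplex X} {j : ℤ} {c : Chains X}
    (hc : c ∈ chainsOn (A : Set (Simplex X)) (j + 1)) :
    boundary X c ∈ chainsOn (A : Set (Simplex X)) j := by
  refine mem_chainsOn.2 fun t ht => ?_
  obtain ⟨s, hs, hst⟩ := apply_ne_zero _ _ _ ht
  obtain ⟨hle, hcard⟩ := boundary_single s t hst
  obtain ⟨hA, hj⟩ := mem_chainsOn.1 hc s hs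
  exact ⟨A.lower hle hA, by push_cast [← hcard] at hj; linarith⟩

lemma augBoundary_mem_augChainsOn {A : Subcomplex X} {j : ℤ} {c : Chains X}
    (hc : c ∈ chainsOn (A : Set (Simplex X)) (j + 1)) :
    augBoundary X (c, 0) ∈ augChainsOn A j := by
  refine ⟨boundary_mem_chainsOn hc, ?_⟩
  split_ifs with hj
  · trivial
  · change augmentation X c = 0
    rw [augmentation, Finsupp.linearCombination_apply, Finsupp.sum]
    refine Finset.sum_eq_zero fun s hs => ?_
    have := (mem_chainsOn.1 hc s (Finsupp.mem_support_iff.1 hs)).2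
    rw [if_neg, smul_zero]
    intro h1
    rw [h1] at this
    push_cast at this
    omega

/-- The homomorphism of reduced homology groups induced by an inclusion of subcomplexes. -/
def redIncl {A B : Subcomplex X} (h : A ≤ B) (j : ℤ) : RedHomology A j →+ RedHomology B j :=
  Subquot.map LinearMap.id
    (fun _ hz => ⟨augChainsOn_mono h j hz.1, hz.2⟩)
    (fun _ hb => Submodule.map_mono (augChainsOn_mono h (j + 1)) hb)

/-- The boundary homomorphism of the long exact sequence of the pair `(X, A)`. -/
def connecting (A : Subcomplex X) (i : ℤ) : RelHomology A (i + 1) →+ RedHomology A i :=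
  Subquot.map (augBoundary X ∘ₗ LinearMap.inl ℤ (Chains X) ℤ)
    (by
      intro c hc
      refine ⟨⟨?_, (augBoundary_mem_augChainsOn (A := ⊤) (j := i) (by simpa using hc.1)).2⟩,
        augBoundary_augBoundary X _⟩
      have h := boundary_mem_chainsOn (A := ⊤) (j := i) (c := c) (by simpa using hc.1)
      exact mem_chainsOn.2 fun s hs =>
        ⟨mem_chainsIn.1 hc.2 s hs, (mem_chainsOn.1 h s hs).2⟩)
    (by
      intro b hb
      obtain ⟨b₁, ⟨e, _, rfl⟩, a, ha, rfl⟩ := Submodule.mem_sup.1 hb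
      refine ⟨(a, 0), ⟨ha, Submodule.zero_mem _⟩, ?_⟩
      have h0 : augBoundary X (boundary X e, 0) = 0 := augBoundary_augBoundary X (e, 0)
      have h1 : (boundary X e + a, (0 : ℤ)) = (boundary X e, 0) + (a, 0) := by simp
      change _ = augBoundary X (boundary X e + a, 0)
      rw [h1, map_add, h0, zero_add])

lemma connecting_mk (A : Subcomplex X) (i : ℤ) (c : Chains X) (hc : c ∈ relCycles A (i + 1)) :
    ∃ h, connecting A i (Subquot.mk c hc) = Subquot.mk (augBoundary X (c, 0)) h := ⟨_, rfl⟩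

lemma redIncl_mk {A B : Subcomplex X} (h : A ≤ B) (j : ℤ) (z : Chains X × ℤ)
    (hz : z ∈ redCycles A j) :
    ∃ h', redIncl h j (Subquot.mk z hz) = Subquot.mk z h' := ⟨_, rfl⟩

lemma le_closedStar (A : Subcomplex X) : A ≤ closedStar A := fun s hs => by
  obtain ⟨v, hv⟩ := simplex_nonempty s
  exact subset_lowerClosure ⟨v, hv, s, hs, hv⟩

lemma nbhd_succ (r : ℕ) (A : Subcomplex X) : nbhd (r + 1) A = closedStar (nbhd r A) :=
  Function.iterate_succ_apply' _ _ _

lemma le_nbhd (r : ℕ) (A : Subcomplex X) : A ≤ nbhd r A := by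
  induction r with
  | zero => exact le_rfl
  | succ r ih => rw [nbhd_succ]; exact ih.trans (le_closedStar _)

lemma nbhd_mono_left {r r' : ℕ} (h : r ≤ r') (A : Subcomplex X) : nbhd r A ≤ nbhd r' A := by
  induction h with
  | refl => exact le_rfl
  | step _ ih => rw [Nat.succ_eq_add_one, nbhd_succ]; exact ih.trans (le_closedStar _)

namespace MetricComplex

/-- `a` is an acyclicity function for `X` in degree `j`. -/
def UniformlyAcyclicInDegree (X : MetricComplex V) (a : ℕ → ℕ) (j : ℤ) : Prop :=
  ∀ (r : ℕ) (A : Subcomplex X), ediam A ≤ r →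
    ∀ x : RedHomology A j, redIncl (le_nbhd (a r) A) j x = 0

/-- `X` is uniformly acyclic, with acyclicity function `a`. -/
def UniformlyAcyclic (X : MetricComplex V) (a : ℕ → ℕ) : Prop :=
  ∀ j : ℤ, 0 ≤ j → X.UniformlyAcyclicInDegree a j

/-- `X` is uniformly `m`-acyclic (that is, uniformly acyclic in the degrees `0, …, m`), with
acyclicity function `a`. -/
def UniformlyAcyclicUpTo (X : MetricComplex V) (m : ℤ) (a : ℕ → ℕ) : Prop :=
  ∀ j : ℤ, 0 ≤ j → j ≤ m → X.UniformlyAcyclicInDegree a j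

end MetricComplex

lemma exists_ediam_le (A : Subcomplex X) (h : (verts A).Finite) : ∃ r : ℕ, ediam A ≤ r := by
  obtain ⟨r, hr⟩ := ((h.prod h).image (fun p : V × V => X.dist p.1 p.2)).bddAbove
  refine ⟨r, iSup₂_le fun v hv => iSup₂_le fun w hw => ?_⟩
  exact_mod_cast hr ⟨(v, w), ⟨hv, hw⟩, rfl⟩

/-- A uniformly acyclic complex is acyclic. -/
lemma redCycles_le_of_uniformlyAcyclic {a : ℕ → ℕ} (ha : X.UniformlyAcyclic a) (j : ℤ) :
    redCycles (⊤ : Subcomplex X) j ≤ redBoundaries ⊤ j := by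
  rintro ⟨c, m⟩ hz
  rcases lt_or_ge j 0 with hj | hj
  · have hc : c = 0 := by
      ext s
      by_contra hs
      have h1 := (mem_chainsOn.1 hz.1.1 s hs).2
      have h2 := Finset.card_pos.2 (simplex_nonempty s)
      omega
    subst hc
    have hm := hz.1.2
    rcases eq_or_ne j (-1) with rfl | hne
    · obtain ⟨v⟩ := X.connected.nonempty
      refine ⟨(Finsupp.single ⟨{v}, X.singleton_mem v⟩ m, 0), ⟨?_, Submodule.zero_mem _⟩, ?_⟩
      · refine mem_chainsOn.2 fun s hs => ?_
        have : s = ⟨{v}, X.singleton_mem v⟩ := by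
          by_contra hcon
          exact hs (Finsupp.single_eq_of_ne hcon)
        subst this
        simp
      · have h0 : ({v} : Finset V).erase v ∉ X.faces := by
          intro h
          simpa using (X.isRelLowerSet_faces h).1
        simp only [augBoundary, LinearMap.comp_apply, LinearMap.fst_apply, LinearMap.prod_apply,
          Function.prod_apply, boundary, augmentation, Finsupp.linearCombination_single,
          Finset.sum_singleton]
        rw [dif_neg h0]
        simp
    · rw [if_neg hne] at hm
      have : m = 0 := hm
      subst this
      exact Submodule.zero_mem _
  · let A : Subcomplex X := lowerClosure (c.support : Set (Simplex X))
    have hfin : (verts A).Finite := by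
      refine (c.support.finite_toSet.biUnion fun s _ => s.1.finite_toSet).subset ?_
      rintro v ⟨s, ⟨t, ht, hst⟩, hv⟩
      exact Set.mem_biUnion ht (hst hv)
    obtain ⟨r, hr⟩ := exists_ediam_le A hfin
    have hzA : (c, m) ∈ redCycles A j :=
      ⟨⟨mem_chainsOn.2 fun s hs => ⟨subset_lowerClosure (Finsupp.mem_support_iff.2 hs),
        (mem_chainsOn.1 hz.1.1 s hs).2⟩, hz.1.2⟩, hz.2⟩
    have h := ha j hj r A hr (Subquot.mk _ hzA)
    obtain ⟨hn, hmk⟩ := redIncl_mk (le_nbhd (a r) A) j _ hzA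
    rw [hmk] at h
    have h' := (Submodule.Quotient.mk_eq_zero _).1 h
    exact Submodule.map_mono (augChainsOn_mono le_top _) h'

lemma augBoundary_eq (c : Chains X × ℤ) : augBoundary X c = augBoundary X (c.1, 0) := rfl

/-- The boundary homomorphism of the pair `(X, A)` is bijective if `X` is uniformly acyclic. -/
lemma connecting_bijective {a : ℕ → ℕ} (ha : X.UniformlyAcyclic a) (A : Subcomplex X) (i : ℤ) :
    Function.Bijective (connecting A i) := by
  constructor
  · rw [injective_iff_map_eq_zero]
    intro x hx
    obtain ⟨c, hc, rfl⟩ := Subquot.exists_mk x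
    obtain ⟨hn, hmk⟩ := connecting_mk A i c hc
    rw [hmk] at hx
    obtain ⟨⟨b, m⟩, hb, hbc⟩ := (Submodule.Quotient.mk_eq_zero _).1 hx
    rw [augBoundary_eq] at hbc
    have hcyc : (c - b, (0 : ℤ)) ∈ redCycles (⊤ : Subcomplex X) (i + 1) := by
      refine ⟨⟨Submodule.sub_mem _ (by simpa using hc.1)
        (chainsOn_mono (Set.subset_univ _) _ hb.1), Submodule.zero_mem _⟩, ?_⟩
      have h1 : (c - b, (0 : ℤ)) = (c, 0) - (b, 0) := by simp
      change augBoundary X (c - b, 0) = 0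
      rw [h1, map_sub, sub_eq_zero]
      exact hbc.symm
    obtain ⟨e, he, hec⟩ := redCycles_le_of_uniformlyAcyclic ha _ hcyc
    refine (Submodule.Quotient.mk_eq_zero _).2 ?_
    have h2 : boundary X e.1 = c - b := congrArg Prod.fst hec
    exact Submodule.mem_sup.2 ⟨boundary X e.1, ⟨e.1, by simpa using he.1, rfl⟩, b, hb.1,
      by rw [h2]; simp⟩
  · intro x
    obtain ⟨z, hz, rfl⟩ := Subquot.exists_mk x
    have hz' : z ∈ redCycles (⊤ : Subcomplex X) i := ⟨augChainsOn_mono le_top _ hz.1, hz.2⟩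
    obtain ⟨e, he, hec⟩ := redCycles_le_of_uniformlyAcyclic ha _ hz'
    rw [augBoundary_eq] at hec
    have hrel : e.1 ∈ relCycles A (i + 1) := by
      refine ⟨by simpa using he.1, ?_⟩
      have h2 : boundary X e.1 = z.1 := congrArg Prod.fst hec
      change boundary X e.1 ∈ chainsIn _
      rw [h2]
      exact mem_chainsIn.2 fun s hs => (mem_chainsOn.1 hz.1.1 s hs).1
    obtain ⟨hn, hmk⟩ := connecting_mk A i e.1 hrel
    refine ⟨Subquot.mk e.1 hrel, ?_⟩
    rw [hmk, Subquot.mk_eq_mk, hec, sub_self]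
    exact Submodule.zero_mem _

/-- The inverse of the boundary homomorphism of the pair `(X, A)`. -/
def connectingInv {a : ℕ → ℕ} (ha : X.UniformlyAcyclic a) (A : Subcomplex X) (i : ℤ) :
    RedHomology A i →+ RelHomology A (i + 1) :=
  (AddEquiv.ofBijective (connecting A i) (connecting_bijective ha A i)).symm.toAddMonoidHom

/-! ### Compactly supported cohomology -/

/-- A homomorphism of chain groups is locally finite if each simplex occurs in the images of
only finitely many simplices. -/
def LocallyFiniteMap (g : Chains X' →ₗ[ℤ] Chains X) : Prop :=
  ∀ s : Simplex X, {t : Simplex X' | g (Finsupp.single t 1) s ≠ 0}.Finite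

/-- The transpose of a locally finite homomorphism of chain groups, acting on compactly supported
cochains: `(gᵀ φ)(t) = φ(g t)`. -/
def transpose (g : Chains X' →ₗ[ℤ] Chains X) (hg : LocallyFiniteMap g) :
    Cochains X →ₗ[ℤ] Cochains X' :=
  Finsupp.linearCombination ℤ fun s =>
    Finsupp.ofSupportFinite (fun t => g (Finsupp.single t 1) s) (hg s)

/-- The evaluation of a cochain on a chain. -/
def pairing (φ : Cochains X) : Chains X →ₗ[ℤ] ℤ := Finsupp.linearCombination ℤ (φ : Simplex X → ℤ)

lemma pairing_apply (φ : Cochains X) (c : Chains X) :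
    pairing φ c = c.sum fun s n => n * φ s := by
  simp [pairing, Finsupp.linearCombination_apply]

lemma pairing_apply' (φ : Cochains X) (c : Chains X) :
    pairing φ c = φ.sum fun s n => n * c s := by
  rw [pairing_apply, Finsupp.sum_of_support_subset _ Finset.subset_union_left,
    Finsupp.sum_of_support_subset (s := c.support ∪ φ.support) _ Finset.subset_union_right]
  · exact Finset.sum_congr rfl fun _ _ => mul_comm _ _
  · simp
  · simp

lemma transpose_apply (g : Chains X' →ₗ[ℤ] Chains X) (hg : LocallyFiniteMap g) (φ : Cochains X)
    (t : Simplex X') : transpose g hg φ t = pairing φ (g (Finsupp.single t 1)) := by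
  rw [pairing_apply', transpose, Finsupp.linearCombination_apply, Finsupp.sum, Finsupp.sum,
    Finsupp.finsetSum_apply]
  rfl

lemma pairing_transpose (g : Chains X' →ₗ[ℤ] Chains X) (hg : LocallyFiniteMap g) (φ : Cochains X)
    (c : Chains X') : pairing (transpose g hg φ) c = pairing φ (g c) := by
  suffices h : pairing (transpose g hg φ) = pairing φ ∘ₗ g from LinearMap.congr_fun h c
  ext1 t; ext1
  simp only [LinearMap.comp_apply, Finsupp.lsingle_apply]
  rw [← transpose_apply g hg, pairing, Finsupp.linearCombination_single, one_smul]

lemma locallyFinite_boundary (X : MetricComplex V) : LocallyFiniteMap (boundary X) := by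
  intro s
  obtain ⟨v, hv⟩ := simplex_nonempty s
  refine ((X.locallyFinite v).preimage (f := Subtype.val)
    (Subtype.val_injective.injOn)).subset fun t ht => ?_
  exact ⟨t.2, (boundary_single t s ht).1 hv⟩

/-- The simplicial coboundary operator on compactly supported cochains, `(δφ)(t) = φ(∂t)`. -/
def coboundary (X : MetricComplex V) : Cochains X →ₗ[ℤ] Cochains X :=
  transpose (boundary X) (locallyFinite_boundary X)

open Classical in
/-- Restriction of cochains to a subcomplex. (Cochains on a subcomplex are identified with the
cochains on `X` which vanish on all other simplices.) -/
def restrict (A : Subcomplex X) : Cochains X →ₗ[ℤ] Cochains X :=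
  (Finsupp.filterAddHom (· ∈ A)).toIntLinearMap

/-- Compactly supported cocycles of a subcomplex. -/
def cocycles (A : Subcomplex X) (i : ℤ) : Submodule ℤ (Cochains X) :=
  chainsOn (A : Set (Simplex X)) i ⊓ LinearMap.ker (restrict A ∘ₗ coboundary X)

/-- Coboundaries of compactly supported cochains of a subcomplex. -/
def coboundaries (A : Subcomplex X) (i : ℤ) : Submodule ℤ (Cochains X) :=
  (chainsOn (A : Set (Simplex X)) (i - 1)).map (restrict A ∘ₗ coboundary X)

/-- The compactly supported cohomology of a subcomplex. -/
abbrev CptCohomology (A : Subcomplex X) (i : ℤ) : Type _ :=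
  Subquot (cocycles A i) (coboundaries A i)

/-- Compactly supported cocycles of the pair `(X, B)`. -/
def relCocycles (B : Subcomplex X) (i : ℤ) : Submodule ℤ (Cochains X) :=
  chainsOn {s | s ∉ B} i ⊓ LinearMap.ker (coboundary X)

/-- Coboundaries of compactly supported cochains of the pair `(X, B)`. -/
def relCoboundaries (B : Subcomplex X) (i : ℤ) : Submodule ℤ (Cochains X) :=
  (chainsOn {s | s ∉ B} (i - 1)).map (coboundary X)

/-- The compactly supported cohomology of the pair `(X, B)`. -/
abbrev RelCptCohomology (B : Subcomplex X) (i : ℤ) : Type _ :=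
  Subquot (relCocycles B i) (relCoboundaries B i)

open Classical in
lemma restrict_apply (A : Subcomplex X) (φ : Cochains X) (s : Simplex X) :
    restrict A φ s = if s ∈ A then φ s else 0 := Finsupp.filter_apply _ _ _

lemma restrict_top (φ : Cochains X) : restrict ⊤ φ = φ := by
  ext s; rw [restrict_apply, if_pos (LowerSet.mem_top)]

lemma restrict_restrict {A B : Subcomplex X} (h : B ≤ A) (φ : Cochains X) :
    restrict B (restrict A φ) = restrict B φ := by
  ext s
  simp only [restrict_apply]
  split_ifs with h1 h2
  · rfl
  · exact absurd (h h1) h2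
  · rfl

lemma restrict_mem_chainsOn {A : Subcomplex X} {i : ℤ} {φ : Cochains X}
    (h : φ ∈ chainsOn Set.univ i) : restrict A φ ∈ chainsOn (A : Set (Simplex X)) i := by
  refine mem_chainsOn.2 fun s hs => ?_
  rw [restrict_apply] at hs
  split_ifs at hs with h1
  · exact ⟨h1, (mem_chainsOn.1 h s hs).2⟩
  · exact absurd rfl hs

lemma pairing_restrict {A : Subcomplex X} {φ : Cochains X} {c : Chains X}
    (hc : c ∈ chainsIn (A : Set (Simplex X))) : pairing (restrict A φ) c = pairing φ c := by
  rw [pairing_apply, pairing_apply]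
  refine Finset.sum_congr rfl fun s hs => ?_
  change c s * restrict A φ s = c s * φ s
  have h : s ∈ A := mem_chainsIn.1 hc s (Finsupp.mem_support_iff.1 hs)
  rw [restrict_apply, if_pos h]

lemma restrict_coboundary_restrict {A : Subcomplex X} (φ : Cochains X) :
    restrict A (coboundary X (restrict A φ)) = restrict A (coboundary X φ) := by
  ext t
  rw [restrict_apply, restrict_apply]
  split_ifs with ht
  · rw [coboundary, transpose_apply, transpose_apply, pairing_restrict]
    exact mem_chainsIn.2 fun s hs => A.lower (boundary_single t s hs).1 ht
  · rfl

/-- The restriction homomorphism in compactly supported cohomology. -/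
def cohRestrict {A B : Subcomplex X} (h : B ≤ A) (i : ℤ) :
    CptCohomology A i →+ CptCohomology B i :=
  Subquot.map (restrict B)
    (fun φ hφ => by
      refine ⟨restrict_mem_chainsOn (chainsOn_mono (Set.subset_univ _) _ hφ.1), ?_⟩
      have h0 : restrict A (coboundary X φ) = 0 := hφ.2
      change restrict B (coboundary X (restrict B φ)) = 0
      rw [restrict_coboundary_restrict, ← restrict_restrict h, h0, map_zero])
    (by
      rintro _ ⟨ψ, hψ, rfl⟩
      refine ⟨restrict B ψ, restrict_mem_chainsOn (chainsOn_mono (Set.subset_univ _) _ hψ), ?_⟩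
      change restrict B (coboundary X (restrict B ψ)) = restrict B (restrict A (coboundary X ψ))
      rw [restrict_coboundary_restrict, restrict_restrict h])

/-- The homomorphism `Hⁱ_c(X, B) → Hⁱ_c(X)`. -/
def relToAbs (B : Subcomplex X) (i : ℤ) :
    RelCptCohomology B i →+ CptCohomology (⊤ : Subcomplex X) i :=
  Subquot.map LinearMap.id
    (fun φ hφ => by
      refine ⟨chainsOn_mono (by simp) _ hφ.1, ?_⟩
      have h0 : coboundary X φ = 0 := hφ.2
      change restrict ⊤ (coboundary X φ) = 0
      rw [h0, map_zero])
    (by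
      rintro _ ⟨ψ, hψ, rfl⟩
      exact ⟨ψ, chainsOn_mono (by simp) _ hψ, restrict_top _⟩)

/-! ### Coarse Poincaré duality spaces -/

/-- The support of `h(C_*(A))`: the smallest subcomplex whose chains contain this image. -/
def imageSupport (h : Chains X' →ₗ[ℤ] Chains X) (A : Subcomplex X') : Subcomplex X :=
  lowerClosure {t | ∃ c ∈ chainsIn (A : Set (Simplex X')), h c t ≠ 0}

/-- `h` has displacement at most `d`. This is used for maps between chains and compactly supported
cochains, in all four combinations. -/
def DisplacementLE (h : (Simplex X →₀ ℤ) →ₗ[ℤ] (Simplex X →₀ ℤ)) (d : ℕ) : Prop :=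
  ∀ s : Simplex X, imageSupport h (LowerSet.Iic s) ≤ nbhd d (LowerSet.Iic s)

/-- The structure of a coarse Poincaré duality space of formal dimension `n` on a metric simplicial
complex `X`, with explicit constants: all links have at most `N` simplices, `a` is an acyclicity
function, and the duality operators `P`, `Pbar` and the homotopies `Φ`, `Φbar` are of displacement
at most `D₀`. All (co)chain groups of negative degree are zero. -/
structure CoarsePD (X : MetricComplex V) (n N D₀ : ℕ) (a : ℕ → ℕ) where
  boundedGeometry : X.BoundedGeometry N
  acyclic : X.UniformlyAcyclic a
  P : Cochains X →ₗ[ℤ] Chains X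
  Pbar : Chains X →ₗ[ℤ] Cochains X
  Φ : Chains X →ₗ[ℤ] Chains X
  Φbar : Cochains X →ₗ[ℤ] Cochains X
  P_degree : ∀ (i : ℤ), ∀ φ ∈ chainsOn Set.univ i, P φ ∈ chainsOn Set.univ (n - i)
  Pbar_degree : ∀ (j : ℤ), ∀ c ∈ chainsOn Set.univ j, Pbar c ∈ chainsOn Set.univ (n - j)
  Φ_degree : ∀ (j : ℤ), ∀ c ∈ chainsOn Set.univ j, Φ c ∈ chainsOn Set.univ (j + 1)
  Φbar_degree : ∀ (i : ℤ), ∀ φ ∈ chainsOn Set.univ i, Φbar φ ∈ chainsOn Set.univ (i - 1)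
  P_comm : ∀ φ, P (coboundary X φ) = boundary X (P φ)
  Pbar_comm : ∀ c, Pbar (boundary X c) = coboundary X (Pbar c)
  homotopy : ∀ c, P (Pbar c) - c = boundary X (Φ c) + Φ (boundary X c)
  homotopy_bar : ∀ φ, Pbar (P φ) - φ = coboundary X (Φbar φ) + Φbar (coboundary X φ)
  P_displacement : DisplacementLE P D₀
  Pbar_displacement : DisplacementLE Pbar D₀
  Φ_displacement : DisplacementLE Φ D₀
  Φbar_displacement : DisplacementLE Φbar D₀

/-- A uniformly proper chain map `C_*(X') → C_*(X)` preserving the augmentations, with Lipschitz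
constant at most `L` and distortion function `φ`. -/
structure UniformlyProperChainMap (X' : MetricComplex V') (X : MetricComplex V) (L : ℕ)
    (φ : ℝ≥0 → ℝ≥0) where
  toLin : Chains X' →ₗ[ℤ] Chains X
  degree : ∀ (j : ℤ), ∀ c ∈ chainsOn Set.univ j, toLin c ∈ chainsOn Set.univ j
  comm : ∀ c, toLin (boundary X' c) = boundary X (toLin c)
  augmentation_comp : ∀ c, augmentation X (toLin c) = augmentation X' c
  lipschitz : ∀ s : Simplex X', ediam (imageSupport toLin (LowerSet.Iic s)) ≤ L
  proper : Tendsto φ atTop atTop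
  distortion : ∀ (r : ℝ≥0) (A : Subcomplex X'), (r : ℝ≥0∞) ≤ ediam A →
    (φ r : ℝ≥0∞) ≤ ediam (imageSupport toLin A)

/-! ### Separation of tubular neighbourhoods -/

/-- Two subcomplexes have a common vertex. -/
def Meets (A B : Subcomplex X) : Prop := ∃ v, v ∈ verts A ∧ v ∈ verts B

lemma Meets.closedStar {A B : Subcomplex X} (h : Meets (closedStar A) B) : Meets A (closedStar B) := by
  obtain ⟨v, ⟨s, ⟨t, ⟨w, hw, hwA⟩, hst⟩, hvs⟩, hvB⟩ := h
  exact ⟨w, hwA, t, subset_lowerClosure ⟨v, hst hvs, hvB⟩, hw⟩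

lemma Meets.nbhd {A B : Subcomplex X} {d : ℕ} (h : Meets (nbhd d A) B) : Meets A (nbhd d B) := by
  induction d generalizing B with
  | zero => exact h
  | succ d ih =>
    rw [nbhd_succ] at h
    have := ih h.closedStar
    rwa [CoarseAlexander.nbhd, ← Function.iterate_succ_apply] at this

lemma nbhd_mono {A B : Subcomplex X} (h : A ≤ B) (d : ℕ) : nbhd d A ≤ nbhd d B := by
  induction d with
  | zero => exact h
  | succ d ih =>
    rw [nbhd_succ, nbhd_succ]
    refine lowerClosure_mono ?_
    rintro t ⟨v, hv, s, hs, hvs⟩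
    exact ⟨v, hv, s, ih hs, hvs⟩

lemma nbhd_nbhd (d e : ℕ) (A : Subcomplex X) : nbhd d (nbhd e A) = nbhd (d + e) A :=
  (Function.iterate_add_apply _ _ _ _).symm

lemma not_meets_coComplement_closedStar {A : Subcomplex X} : ¬ Meets (coComplement (closedStar A)) A := by
  rintro ⟨v, ⟨s, ⟨t, ht, hst⟩, hvs⟩, hvA⟩
  exact ht (subset_lowerClosure ⟨v, hst hvs, hvA⟩)

lemma exists_single {h : Chains X' →ₗ[ℤ] Chains X} {A : Subcomplex X'} {c : Chains X'}
    (hc : c ∈ chainsIn (A : Set (Simplex X'))) {t : Simplex X} (ht : h c t ≠ 0) :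
    ∃ s ∈ A, t ∈ imageSupport h (LowerSet.Iic s) := by
  obtain ⟨s, hs, hst⟩ := apply_ne_zero _ _ _ ht
  refine ⟨s, mem_chainsIn.1 hc s hs, subset_lowerClosure ⟨Finsupp.single s 1, ?_, hst⟩⟩
  refine mem_chainsIn.2 fun s' hs' => ?_
  have : s' = s := by
    by_contra hcon
    exact hs' (Finsupp.single_eq_of_ne hcon)
  subst this
  exact LowerSet.mem_Iic_iff.2 le_rfl

lemma restrict_eq_zero_of_displacement {h : Chains X →ₗ[ℤ] Cochains X} {d : ℕ}
    (hd : DisplacementLE h d) {A B : Subcomplex X} (hAB : ¬ Meets A (nbhd d B)) {c : Chains X}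
    (hc : c ∈ chainsIn (A : Set (Simplex X))) : restrict B (h c) = 0 := by
  ext t
  rw [restrict_apply]
  split_ifs with htB
  · by_contra ht
    obtain ⟨s, hs, hst⟩ := exists_single hc ht
    obtain ⟨v, hv⟩ := simplex_nonempty t
    refine hAB (Meets.nbhd ⟨v, ⟨t, ?_, hv⟩, ⟨t, htB, hv⟩⟩)
    exact nbhd_mono (LowerSet.Iic_le.2 hs) d (hd s hst)
  · rfl

/-! ### The Alexander duality homomorphisms -/

namespace CoarsePD

variable {n N D₀ : ℕ} {a : ℕ → ℕ}

/-- The cochains `Pbar c`, `c ∈ C_*(A)`, vanish on the subcomplex `B`. -/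
def Separates (E : CoarsePD X n N D₀ a) (A B : Subcomplex X) : Prop :=
  ∀ c ∈ chainsIn (A : Set (Simplex X)), restrict B (E.Pbar c) = 0

/-- The homomorphism `Hⱼ(X, A) → Hⁿ⁻ʲ_c(B)` induced by `Pbar` and restriction to `B`. -/
def pbarMap (E : CoarsePD X n N D₀ a) {A B : Subcomplex X} (h : E.Separates A B) (j m : ℤ)
    (hjm : j + m = n) : RelHomology A j →+ CptCohomology B m :=
  Subquot.map (restrict B ∘ₗ E.Pbar)
    (fun c hc => by
      have hm : m = n - j := by linarith
      subst hm
      refine ⟨restrict_mem_chainsOn (E.Pbar_degree j c hc.1), ?_⟩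
      change restrict B (coboundary X (restrict B (E.Pbar c))) = 0
      rw [restrict_coboundary_restrict, ← E.Pbar_comm]
      exact h _ hc.2)
    (fun b hb => by
      have hm : m - 1 = n - (j + 1) := by linarith
      obtain ⟨b₁, ⟨e, he, rfl⟩, b₂, hb₂, rfl⟩ := Submodule.mem_sup.1 hb
      refine ⟨restrict B (E.Pbar e), restrict_mem_chainsOn (hm ▸ E.Pbar_degree _ e he), ?_⟩
      have h2 : restrict B (E.Pbar b₂) = 0 :=
        h _ (mem_chainsIn.2 fun s hs => (mem_chainsOn.1 hb₂ s hs).1)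
      change restrict B (coboundary X (restrict B (E.Pbar e)))
        = restrict B (E.Pbar (boundary X e + b₂))
      rw [restrict_coboundary_restrict, map_add, map_add, h2, add_zero, E.Pbar_comm])

/-- The Alexander duality homomorphism
`H̃ᵢ(A) ≅ Hᵢ₊₁(X, A) → Hᵐ_c(B)`, where `i + 1 + m = n`. -/
def alexander (E : CoarsePD X n N D₀ a) {A B : Subcomplex X} (h : E.Separates A B) (i m : ℤ)
    (him : i + 1 + m = n) : RedHomology A i →+ CptCohomology B m :=
  (E.pbarMap h (i + 1) m him).comp (connectingInv E.acyclic A i)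

lemma connecting_connectingInv (E : CoarsePD X n N D₀ a) (A : Subcomplex X) (i : ℤ)
    (x : RedHomology A i) : connecting A i (connectingInv E.acyclic A i x) = x :=
  (AddEquiv.ofBijective (connecting A i) (connecting_bijective E.acyclic A i)).apply_symm_apply x

lemma connectingInv_connecting (E : CoarsePD X n N D₀ a) (A : Subcomplex X) (i : ℤ)
    (y : RelHomology A (i + 1)) : connectingInv E.acyclic A i (connecting A i y) = y :=
  (AddEquiv.ofBijective (connecting A i) (connecting_bijective E.acyclic A i)).symm_apply_apply y

/-- The Alexander duality homomorphisms are natural. -/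
lemma alexander_natural (E : CoarsePD X n N D₀ a) {A A' B B' : Subcomplex X} (hA : A ≤ A')
    (hB : B' ≤ B) (h : E.Separates A B) (h' : E.Separates A' B') (i m : ℤ) (him : i + 1 + m = n)
    (x : RedHomology A i) :
    E.alexander h' i m him (redIncl hA i x) = cohRestrict hB m (E.alexander h i m him x) := by
  obtain ⟨y, rfl⟩ := (connecting_bijective E.acyclic A i).2 x
  obtain ⟨c, hc, rfl⟩ := Subquot.exists_mk y
  have hc' : c ∈ relCycles A' (i + 1) :=
    ⟨hc.1, mem_chainsIn.2 fun s hs => hA (mem_chainsIn.1 hc.2 s hs)⟩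
  have h1 : redIncl hA i (connecting A i (Subquot.mk c hc))
      = connecting A' i (Subquot.mk c hc') := rfl
  have h2 : E.pbarMap h' (i + 1) m him (Subquot.mk c hc')
      = cohRestrict hB m (E.pbarMap h (i + 1) m him (Subquot.mk c hc)) := by
    obtain ⟨e₁, h₁⟩ : ∃ e, E.pbarMap h' (i + 1) m him (Subquot.mk c hc')
      = Subquot.mk (restrict B' (E.Pbar c)) e := ⟨_, rfl⟩
    obtain ⟨e₂, h₂⟩ : ∃ e, cohRestrict hB m (E.pbarMap h (i + 1) m him (Subquot.mk c hc))
      = Subquot.mk (restrict B' (restrict B (E.Pbar c))) e := ⟨_, rfl⟩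
    rw [h₁, h₂, Subquot.mk_eq_mk, restrict_restrict hB, sub_self]
    exact Submodule.zero_mem _
  have h3 := E.connectingInv_connecting A i (Subquot.mk c hc)
  have h4 := E.connectingInv_connecting A' i (Subquot.mk c hc')
  calc _ = E.pbarMap h' (i + 1) m him (connectingInv E.acyclic A' i
        (connecting A' i (Subquot.mk c hc'))) := rfl
    _ = E.pbarMap h' (i + 1) m him (Subquot.mk c hc') := congrArg _ h4
    _ = _ := h2
    _ = cohRestrict hB m (E.pbarMap h (i + 1) m him (connectingInv E.acyclic A i
        (connecting A i (Subquot.mk c hc)))) := 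
          (congrArg (fun z => cohRestrict hB m (E.pbarMap h (i + 1) m him z)) h3).symm

end CoarsePD

/-! ### Chain maps -/

namespace UniformlyProperChainMap

variable {L : ℕ} {φ : ℝ≥0 → ℝ≥0}

/-- The subcomplex `K = Support(f(C_*(X')))`. -/
def image (f : UniformlyProperChainMap X' X L φ) : Subcomplex X := imageSupport f.toLin ⊤

lemma apply_mem_chainsIn (f : UniformlyProperChainMap X' X L φ) {A : Subcomplex X}
    (h : f.image ≤ A) (c : Chains X') : f.toLin c ∈ chainsIn (A : Set (Simplex X)) :=
  mem_chainsIn.2 fun _ ht => h (subset_lowerClosure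
    ⟨c, mem_chainsIn.2 fun _ _ => LowerSet.mem_top, ht⟩)

end UniformlyProperChainMap

lemma MetricComplex.dist_self (X : MetricComplex V) (v : V) : X.dist v v = 0 := SimpleGraph.dist_self

lemma MetricComplex.dist_comm (X : MetricComplex V) (v w : V) : X.dist v w = X.dist w v := SimpleGraph.dist_comm

lemma MetricComplex.dist_triangle (X : MetricComplex V) (u v w : V) : X.dist u w ≤ X.dist u v + X.dist v w :=
  X.connected.dist_triangle

/-- Balls in a metric simplicial complex are finite. -/
lemma finite_ball (X : MetricComplex V) (v : V) (r : ℕ) : {w | X.dist v w ≤ r}.Finite := by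
  induction r with
  | zero =>
    refine (Set.finite_singleton v).subset fun w hw => ?_
    have h0 : X.dist v w = 0 := Nat.le_zero.1 hw
    exact (X.connected.dist_eq_zero_iff.1 h0).symm
  | succ r ih =>
    have hfin : (⋃ u ∈ {w | X.dist v w ≤ r}, ⋃ s ∈ {s ∈ X.faces | u ∈ s}, (s : Set V)).Finite :=
      ih.biUnion fun u _ => (X.locallyFinite u).biUnion fun s _ => s.finite_toSet
    refine (ih.union hfin).subset fun w hw => ?_
    by_cases hle : X.dist v w ≤ r
    · exact Or.inl hle
    · have heq : X.dist v w = r + 1 := le_antisymm hw (by omega)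
      obtain ⟨p, hp⟩ := X.connected.exists_walk_length_eq_dist v w
      have hp' : p.length = r + 1 := hp.trans heq
      have hnil : ¬ p.Nil := by
        intro hn
        rw [← SimpleGraph.Walk.length_eq_zero_iff] at hn
        omega
      right
      have hadj := p.adj_penultimate hnil
      obtain ⟨_, s, hs, h1, h2⟩ := hadj
      refine Set.mem_biUnion (x := p.penultimate) ?_ (Set.mem_biUnion (x := s) ⟨hs, h1⟩ h2)
      have h3 := SimpleGraph.dist_le p.dropLast
      have h4 : p.dropLast.length = r := by
        rw [SimpleGraph.Walk.length_dropLast, hp']; rfl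
      rw [h4] at h3
      exact h3

lemma dist_le_of_ediam_le {A : Subcomplex X} {r : ℕ} (h : ediam A ≤ r) {v w : V}
    (hv : v ∈ verts A) (hw : w ∈ verts A) : X.dist v w ≤ r := by
  have h1 : (X.dist v w : ℝ≥0∞) ≤ ediam A :=
    (le_iSup₂ (f := fun w (_ : w ∈ verts A) => (X.dist v w : ℝ≥0∞)) w hw).trans
      (le_iSup₂ (f := fun v (_ : v ∈ verts A) => ⨆ w ∈ verts A, (X.dist v w : ℝ≥0∞)) v hv)
  exact_mod_cast h1.trans h

/-- Uniformly proper chain maps induce maps of compactly supported cochains. -/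
lemma UniformlyProperChainMap.locallyFinite {L : ℕ} {φ : ℝ≥0 → ℝ≥0}
    (f : UniformlyProperChainMap X' X L φ) : LocallyFiniteMap f.toLin := by
  intro s
  rcases Set.eq_empty_or_nonempty {t | f.toLin (Finsupp.single t 1) s ≠ 0} with h0 | ⟨t₀, ht₀⟩
  · rw [h0]; exact Set.finite_empty
  obtain ⟨v, hv⟩ := simplex_nonempty s
  have key : ∀ t : Simplex X', f.toLin (Finsupp.single t 1) s ≠ 0 →
      s ∈ imageSupport f.toLin (LowerSet.Iic t) := by
    intro t ht
    refine subset_lowerClosure ⟨_, mem_chainsIn.2 fun s' hs' => ?_, ht⟩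
    have : s' = t := by
      by_contra hcon
      exact hs' (Finsupp.single_eq_of_ne hcon)
    subst this
    exact LowerSet.mem_Iic_iff.2 le_rfl
  obtain ⟨r, hr⟩ := (tendsto_atTop.1 f.proper (2 * L + 1 : ℝ≥0)).exists
  obtain ⟨v₀, hv₀⟩ := simplex_nonempty t₀
  obtain ⟨m, hm⟩ := exists_nat_ge r
  have hfin : {t : Simplex X' | ∃ w ∈ {w | X'.dist v₀ w ≤ m}, w ∈ t.1}.Finite := by
    have h1 : (⋃ w ∈ {w | X'.dist v₀ w ≤ m}, {t : Simplex X' | w ∈ t.1}).Finite := by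
      refine (finite_ball X' v₀ m).biUnion fun w _ => ?_
      refine ((X'.locallyFinite w).preimage (f := Subtype.val)
        (Subtype.val_injective.injOn)).subset fun t ht => ⟨t.2, ht⟩
    refine h1.subset ?_
    rintro t ⟨w, hw, hwt⟩
    exact Set.mem_biUnion hw hwt
  refine hfin.subset fun t ht => ?_
  obtain ⟨w, hw⟩ := simplex_nonempty t
  refine ⟨w, ?_, hw⟩
  by_contra hcon
  let A : Subcomplex X' := LowerSet.Iic t₀ ⊔ LowerSet.Iic t
  have hA : (r : ℝ≥0∞) ≤ ediam A := by
    have h1 : (X'.dist v₀ w : ℝ≥0∞) ≤ ediam A := by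
      refine (le_iSup₂ (f := fun w (_ : w ∈ verts A) => (X'.dist v₀ w : ℝ≥0∞)) w ?_).trans
        (le_iSup₂ (f := fun v (_ : v ∈ verts A) => ⨆ w ∈ verts A, (X'.dist v w : ℝ≥0∞)) v₀ ?_)
      · exact ⟨t, Or.inr (LowerSet.mem_Iic_iff.2 le_rfl), hw⟩
      · exact ⟨t₀, Or.inl (LowerSet.mem_Iic_iff.2 le_rfl), hv₀⟩
    refine le_trans ?_ h1
    have h2 : m ≤ X'.dist v₀ w := (not_le.1 hcon).le
    have h3 : r ≤ (X'.dist v₀ w : ℝ≥0) := hm.trans (by exact_mod_cast h2)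
    exact_mod_cast h3
  have hclose : ∀ x ∈ verts (imageSupport f.toLin A), X.dist v x ≤ L := by
    rintro x ⟨y, ⟨z, ⟨c, hc, hcz⟩, hyz⟩, hx⟩
    obtain ⟨q, hq, hzq⟩ := exists_single hc hcz
    have hz : ∃ q' : Simplex X', f.toLin (Finsupp.single q' 1) s ≠ 0 ∧
        q ∈ LowerSet.Iic q' := by
      rcases hq with hq | hq
      · exact ⟨t₀, ht₀, hq⟩
      · exact ⟨t, ht, hq⟩
    obtain ⟨q', hq', hqq⟩ := hz
    refine dist_le_of_ediam_le (f.lipschitz q') ⟨s, key q' hq', hv⟩ ⟨z, ?_, hyz hx⟩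
    obtain ⟨z', ⟨c', hc', hcz'⟩, hzz'⟩ := hzq
    exact ⟨z', ⟨c', mem_chainsIn.2 fun p hp => (LowerSet.mem_Iic_iff.1
      (mem_chainsIn.1 hc' p hp)).trans (LowerSet.mem_Iic_iff.1 hqq), hcz'⟩, hzz'⟩
  have hub : ediam (imageSupport f.toLin A) ≤ ((2 * L : ℕ) : ℝ≥0∞) := by
    refine iSup₂_le fun x hx => iSup₂_le fun y hy => ?_
    have h1 := X.dist_triangle x v y
    rw [X.dist_comm x v] at h1
    have h2 := hclose x hx
    have h3 := hclose y hy
    exact_mod_cast (show X.dist x y ≤ 2 * L by omega)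
  have h4 := (f.distortion r A hA).trans hub
  have h5 : φ r ≤ ((2 * L : ℕ) : ℝ≥0) := by exact_mod_cast h4
  have h6 : (2 * L + 1 : ℝ≥0) ≤ 2 * L := hr.trans (by exact_mod_cast h5)
  have h7 : (2 * L + 1 : ℕ) ≤ 2 * L := by exact_mod_cast h6
  omega

namespace UniformlyProperChainMap

variable {L : ℕ} {φ : ℝ≥0 → ℝ≥0}

/-- The homomorphism `H̃ᵢ(X') → H̃ᵢ(A)` induced by `f`, for a subcomplex `A` containing `K`. -/
def homologyMap (f : UniformlyProperChainMap X' X L φ) {A : Subcomplex X} (h : f.image ≤ A)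
    (i : ℤ) : RedHomology (⊤ : Subcomplex X') i →+ RedHomology A i :=
  have haug : ∀ c m, augBoundary X (f.toLin c, m)
      = f.toLin.prodMap LinearMap.id (augBoundary X' (c, m)) := fun c _ =>
    Prod.ext (f.comm c).symm (f.augmentation_comp c)
  have hdeg : ∀ (j : ℤ) (z : Chains X' × ℤ), z ∈ augChainsOn (⊤ : Subcomplex X') j →
      f.toLin.prodMap LinearMap.id z ∈ augChainsOn A j := fun j z hz =>
    ⟨mem_chainsOn.2 fun s hs => ⟨mem_chainsIn.1 (f.apply_mem_chainsIn h z.1) s hs,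
      (mem_chainsOn.1 (f.degree j z.1 (chainsOn_mono (Set.subset_univ _) _ hz.1)) s hs).2⟩, hz.2⟩
  Subquot.map (f.toLin.prodMap LinearMap.id)
    (fun z hz => ⟨hdeg i z hz.1, (haug z.1 z.2).trans (by
      have h0 : augBoundary X' (z.1, z.2) = 0 := hz.2
      rw [h0, map_zero])⟩)
    (by
      rintro _ ⟨e, he, rfl⟩
      exact ⟨_, hdeg (i + 1) e he, haug e.1 e.2⟩)

/-- The homomorphism `Hⁱ_c(A) → Hⁱ_c(X')` induced by `f`, for a subcomplex `A` containing `K`. -/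
def cohomologyMap (f : UniformlyProperChainMap X' X L φ) {A : Subcomplex X} (h : f.image ≤ A)
    (i : ℤ) : CptCohomology A i →+ CptCohomology (⊤ : Subcomplex X') i :=
  have hdeg : ∀ (j : ℤ) (ψ : Cochains X), ψ ∈ chainsOn (A : Set (Simplex X)) j →
      transpose f.toLin f.locallyFinite ψ ∈ chainsOn ((⊤ : Subcomplex X') : Set (Simplex X')) j := by
    intro j ψ hψ
    refine mem_chainsOn.2 fun t ht => ⟨LowerSet.mem_top, ?_⟩
    rw [transpose_apply, pairing_apply] at ht
    obtain ⟨s, hs, hne⟩ := Finset.exists_ne_zero_of_sum_ne_zero ht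
    have h1 : f.toLin (Finsupp.single t 1) ∈ chainsOn Set.univ ((t.1.card : ℤ) - 1) := by
      refine f.degree _ _ (mem_chainsOn.2 fun t' ht' => ⟨trivial, ?_⟩)
      have : t' = t := by
        by_contra hcon
        exact ht' (Finsupp.single_eq_of_ne hcon)
      subst this
      ring
    have h2 := (mem_chainsOn.1 h1 s (Finsupp.mem_support_iff.1 hs)).2
    have h3 := (mem_chainsOn.1 hψ s (right_ne_zero_of_mul hne)).2
    linarith
  have hres : ∀ ψ : Cochains X, transpose f.toLin f.locallyFinite (restrict A ψ)
      = transpose f.toLin f.locallyFinite ψ := by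
    intro ψ
    ext t
    rw [transpose_apply, transpose_apply, pairing_restrict (f.apply_mem_chainsIn h _)]
  have hcomm : ∀ ψ : Cochains X, restrict ⊤ (coboundary X' (transpose f.toLin f.locallyFinite ψ))
      = transpose f.toLin f.locallyFinite (restrict A (coboundary X ψ)) := by
    intro ψ
    rw [hres, restrict_top]
    ext t
    rw [coboundary, transpose_apply, pairing_transpose, transpose_apply, coboundary,
      pairing_transpose, f.comm]
  Subquot.map (transpose f.toLin f.locallyFinite)
    (fun ψ hψ => ⟨hdeg i ψ hψ.1, (hcomm ψ).trans (by
      have h0 : restrict A (coboundary X ψ) = 0 := hψ.2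
      rw [h0, map_zero])⟩)
    (by
      rintro _ ⟨ψ, hψ, rfl⟩
      exact ⟨_, hdeg (i - 1) ψ hψ, hcomm ψ⟩)

lemma cohomologyMap_cohRestrict (f : UniformlyProperChainMap X' X L φ) {A B : Subcomplex X}
    (hB : f.image ≤ B) (h : B ≤ A) (i : ℤ) (x : CptCohomology A i) :
    f.cohomologyMap hB i (cohRestrict h i x) = f.cohomologyMap (hB.trans h) i x := by
  obtain ⟨ψ, hψ, rfl⟩ := Subquot.exists_mk x
  obtain ⟨e₁, h₁⟩ : ∃ e, f.cohomologyMap hB i (cohRestrict h i (Subquot.mk ψ hψ))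
    = Subquot.mk (transpose f.toLin f.locallyFinite (restrict B ψ)) e := ⟨_, rfl⟩
  obtain ⟨e₂, h₂⟩ : ∃ e, f.cohomologyMap (hB.trans h) i (Subquot.mk ψ hψ)
    = Subquot.mk (transpose f.toLin f.locallyFinite ψ) e := ⟨_, rfl⟩
  have h3 : transpose f.toLin f.locallyFinite (restrict B ψ)
      = transpose f.toLin f.locallyFinite ψ := by
    ext t
    rw [transpose_apply, transpose_apply, pairing_restrict (f.apply_mem_chainsIn hB _)]
  rw [h₁, h₂, Subquot.mk_eq_mk, h3, sub_self]
  exact Submodule.zero_mem _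

end UniformlyProperChainMap

/-! ### Inverse and direct systems, approximate isomorphisms -/

/-- An inverse system of abelian groups. -/
structure InvSystem (I : Type*) [Preorder I] where
  obj : I → Type w
  [grp : ∀ i, AddCommGroup (obj i)]
  proj : ∀ {i j : I}, i ≤ j → (obj j →+ obj i)
  proj_id : ∀ {i : I} (h : i ≤ i) (x : obj i), proj h x = x
  proj_comp : ∀ {i j k : I} (h : i ≤ j) (h' : j ≤ k) (x : obj k),
    proj h (proj h' x) = proj (h.trans h') x

/-- A direct system of abelian groups. -/
structure DirSystem (I : Type*) [Preorder I] where
  obj : I → Type w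
  [grp : ∀ i, AddCommGroup (obj i)]
  proj : ∀ {i j : I}, i ≤ j → (obj i →+ obj j)
  proj_id : ∀ {i : I} (h : i ≤ i) (x : obj i), proj h x = x
  proj_comp : ∀ {i j k : I} (h : i ≤ j) (h' : j ≤ k) (x : obj i),
    proj h' (proj h x) = proj (h.trans h') x

attribute [instance] InvSystem.grp DirSystem.grp

/-- The constant inverse system. -/
def InvSystem.const (I : Type*) [Preorder I] (G : Type w) [AddCommGroup G] : InvSystem.{w} I where
  obj _ := G
  proj _ := AddMonoidHom.id G
  proj_id _ _ := rfl
  proj_comp _ _ _ := rfl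

/-- The constant direct system. -/
def DirSystem.const (I : Type*) [Preorder I] (G : Type w) [AddCommGroup G] : DirSystem.{w} I where
  obj _ := G
  proj _ := AddMonoidHom.id G
  proj_id _ _ := rfl
  proj_comp _ _ _ := rfl

/-- A cofinal, order preserving, partially defined map. -/
structure CofinalMap (I J : Type*) [Preorder I] [Preorder J] where
  dom : Set I
  toFun : dom → J
  monotone : Monotone toFun
  tail : ∃ i₀, ∀ i, i₀ ≤ i → i ∈ dom
  cofinal : ∀ S : Set dom, (∀ i, ∃ s ∈ S, i ≤ s.1) → ∀ j, ∃ s ∈ S, j ≤ toFun s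

section Approx

variable {I J : Type*} [LinearOrder I] [LinearOrder J]

/-- An `α`-morphism of inverse systems. -/
structure InvMorphism (A : InvSystem I) (B : InvSystem J) (α : CofinalMap I J) where
  toFun : ∀ i : α.dom, A.obj i →+ B.obj (α.toFun i)
  comm : ∀ (i i' : α.dom) (h : i ≤ i') (x : A.obj i'),
    B.proj (α.monotone h) (toFun i' x) = toFun i (A.proj h x)

/-- An `α`-morphism of direct systems. -/
structure DirMorphism (A : DirSystem I) (B : DirSystem J) (α : CofinalMap I J) where
  toFun : ∀ i : α.dom, A.obj i →+ B.obj (α.toFun i)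
  comm : ∀ (i i' : α.dom) (h : i ≤ i') (x : A.obj i),
    B.proj (α.monotone h) (toFun i x) = toFun i' (A.proj h x)

namespace InvMorphism

variable {A : InvSystem I} {B : InvSystem J} {α : CofinalMap I J}

/-- `ω`-approximate monomorphisms:
`Ker(A_{ω(i)} → B_{α(ω(i))}) ⊆ Ker(A_{ω(i)} → A_i)` for all `i`. -/
def IsApproxMono (f : InvMorphism A B α) (ω : I → I) : Prop :=
  ∀ i : I, ∃ (hd : ω i ∈ α.dom) (hle : i ≤ ω i),
    ∀ x : A.obj (ω i), f.toFun ⟨ω i, hd⟩ x = 0 → A.proj hle x = 0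

/-- `ω`-approximate epimorphisms: `Im(B_{ω(j)} → B_j)` is contained in the union of the images
of the maps `A_i → B_{α(i)} → B_j`, `α(i) ≥ j`, for all `j`. -/
def IsApproxEpi (f : InvMorphism A B α) (ω : J → J) : Prop :=
  ∀ j : J, ∃ hle : j ≤ ω j, ∀ y : B.obj (ω j),
    ∃ (i : α.dom) (hi : j ≤ α.toFun i) (x : A.obj i), B.proj hi (f.toFun i x) = B.proj hle y

/-- Approximate isomorphisms. -/
def IsApproxIso (f : InvMorphism A B α) (ω : I → I) (ω' : J → J) : Prop :=
  f.IsApproxMono ω ∧ f.IsApproxEpi ω'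

end InvMorphism

namespace DirMorphism

variable {A : DirSystem I} {B : DirSystem J} {α : CofinalMap I J}

/-- `ω`-approximate monomorphisms: `Ker(A_i → B_{α(i)}) ⊆ Ker(A_i → A_{ω(i)})` for all `i`. -/
def IsApproxMono (f : DirMorphism A B α) (ω : I → I) : Prop :=
  ∀ i : α.dom, ∃ hle : i.1 ≤ ω i, ∀ x : A.obj i, f.toFun i x = 0 → A.proj hle x = 0

/-- `ω`-approximate epimorphisms: `Im(B_j → B_{ω(j)})` is contained in the union of the images
of the maps `A_i → B_{α(i)} → B_{ω(j)}`, `α(i) ≤ ω(j)`, for all `j`. -/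
def IsApproxEpi (f : DirMorphism A B α) (ω : J → J) : Prop :=
  ∀ j : J, ∃ hle : j ≤ ω j, ∀ y : B.obj j,
    ∃ (i : α.dom) (hi : α.toFun i ≤ ω j) (x : A.obj i), B.proj hi (f.toFun i x) = B.proj hle y

/-- Approximate isomorphisms. -/
def IsApproxIso (f : DirMorphism A B α) (ω : I → I) (ω' : J → J) : Prop :=
  f.IsApproxMono ω ∧ f.IsApproxEpi ω'

end DirMorphism

end Approx

/-- The cofinal map `R ↦ R - D`, defined for `R ≥ D`. -/
def shiftDown (D : ℕ) : CofinalMap ℕ ℕ where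
  dom := {R | D ≤ R}
  toFun R := R.1 - D
  monotone _ _ h := Nat.sub_le_sub_right h D
  tail := ⟨D, fun _ h => h⟩
  cofinal S hS j := by
    obtain ⟨s, hs, h⟩ := hS (j + D)
    exact ⟨s, hs, Nat.le_sub_of_add_le h⟩

/-- The cofinal map `R ↦ R + D`. -/
def shiftUp (D : ℕ) : CofinalMap ℕ ℕ where
  dom := Set.univ
  toFun R := R.1 + D
  monotone _ _ h := Nat.add_le_add_right h D
  tail := ⟨0, fun _ _ => trivial⟩
  cofinal S hS j := by
    obtain ⟨s, hs, h⟩ := hS j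
    exact ⟨s, hs, h.trans (Nat.le_add_right _ _)⟩

/-! ### The systems and morphisms of coarse Alexander duality -/

/-- `Y_R`, the closure of `X - N_R(K)`. -/
def outside (K : Subcomplex X) (R : ℕ) : Subcomplex X := coComplement (nbhd R K)

lemma outside_anti (K : Subcomplex X) {R R' : ℕ} (h : R ≤ R') : outside K R' ≤ outside K R :=
  lowerClosure_mono fun _ ht hcon => ht (nbhd_mono_left h K hcon)

/-- The inverse system `{H̃ⱼ(Y_R)}`. -/
def outsideHomology (K : Subcomplex X) (j : ℤ) : InvSystem.{u} ℕ where
  obj R := RedHomology (outside K R) j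
  proj h := redIncl (outside_anti K h) j
  proj_id _ x := by
    obtain ⟨z, hz, rfl⟩ := Subquot.exists_mk x
    rfl
  proj_comp _ _ x := by
    obtain ⟨z, hz, rfl⟩ := Subquot.exists_mk x
    rfl

/-- The direct system `{Hʲ_c(Y_R)}`. -/
def outsideCohomology (K : Subcomplex X) (j : ℤ) : DirSystem.{u} ℕ where
  obj R := CptCohomology (outside K R) j
  proj h := cohRestrict (outside_anti K h) j
  proj_id {R} _ x := by
    obtain ⟨z, hz, rfl⟩ := Subquot.exists_mk x
    refine Subquot.mk_eq_mk.2 ?_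
    have h0 : restrict (outside K R) z = z := by
      ext s
      rw [restrict_apply]
      split_ifs with hs
      · rfl
      · by_contra hne
        exact hs (mem_chainsOn.1 hz.1 s (Ne.symm hne)).1
    change restrict (outside K R) z - z ∈ _
    rw [h0, sub_self]
    exact Submodule.zero_mem _
  proj_comp {_ R R'} h h' x := by
    obtain ⟨z, hz, rfl⟩ := Subquot.exists_mk x
    refine Subquot.mk_eq_mk.2 ?_
    change restrict (outside K R') (restrict (outside K R) z) - restrict (outside K R') z ∈ _
    rw [restrict_restrict (outside_anti _ h'), sub_self]
    exact Submodule.zero_mem _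

namespace CoarsePD

variable {n N D₀ L : ℕ} {a : ℕ → ℕ} {φ : ℝ≥0 → ℝ≥0}

lemma separates_outside (E : CoarsePD X n N D₀ a) (K : Subcomplex X) (R : ℕ) :
    E.Separates (outside K (R + (D₀ + 1))) (nbhd R K) := by
  intro c hc
  refine restrict_eq_zero_of_displacement E.Pbar_displacement ?_ hc
  rw [nbhd_nbhd, outside, ← add_assoc, nbhd_succ, add_comm R D₀]
  exact not_meets_coComplement_closedStar

lemma separates_outside' (E : CoarsePD X n N D₀ a) (K : Subcomplex X) {R : ℕ} (h : D₀ + 1 ≤ R) :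
    E.Separates (outside K R) (nbhd (R - (D₀ + 1)) K) := by
  obtain ⟨S, rfl⟩ := Nat.exists_eq_add_of_le' h
  rw [Nat.add_sub_cancel]
  exact E.separates_outside K S

lemma separates_nbhd (E : CoarsePD X n N D₀ a) (K : Subcomplex X) (R : ℕ) :
    E.Separates (nbhd R K) (outside K (R + (D₀ + 1))) := by
  intro c hc
  refine restrict_eq_zero_of_displacement E.Pbar_displacement ?_ hc
  rintro ⟨v, hv, hv'⟩
  have h : Meets (nbhd D₀ (outside K (R + (D₀ + 1)))) (nbhd R K) := ⟨v, hv', hv⟩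
  have h' := h.nbhd
  rw [nbhd_nbhd, outside, ← add_assoc, nbhd_succ, add_comm R D₀] at h'
  exact not_meets_coComplement_closedStar h'

/-- For `D = D₀ + 1` and `R ≥ D`, the composition
`H̃_{n-i-1}(Y_R) → Hⁱ_c(N_{R-D}(K)) → Hⁱ_c(X')` of the Alexander duality homomorphism with the
homomorphism induced by `f`, where `K` is the support of the image of `f`. -/
def homologyToMap (E : CoarsePD X n N D₀ a) (f : UniformlyProperChainMap X' X L φ) (i : ℤ) {R : ℕ}
    (hR : D₀ + 1 ≤ R) :
    RedHomology (outside f.image R) (n - i - 1) →+ CptCohomology (⊤ : Subcomplex X') i :=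
  (f.cohomologyMap (le_nbhd (R - (D₀ + 1)) f.image) i).comp
    (E.alexander (E.separates_outside' f.image hR) (n - i - 1) i (by ring))

/-- For `D = D₀ + 1`, the composition `H̃ᵢ(X') → H̃ᵢ(N_R(K)) → H_c^{n-i-1}(Y_{R+D})` of the
homomorphism induced by `f` with the Alexander duality homomorphism. -/
def mapToCohomology (E : CoarsePD X n N D₀ a) (f : UniformlyProperChainMap X' X L φ) (i : ℤ)
    (R : ℕ) : RedHomology (⊤ : Subcomplex X') i →+
      CptCohomology (outside f.image (R + (D₀ + 1))) (n - i - 1) :=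
  (E.alexander (E.separates_nbhd f.image R) i (n - i - 1) (by ring)).comp
    (f.homologyMap (le_nbhd R f.image) i)

/-- The family of compositions `H̃_{n-i-1}(Y_R) → Hⁱ_c(N_{R-D}(K)) → Hⁱ_c(X')`, as a morphism
of inverse systems. -/
def homologyMorphism (E : CoarsePD X n N D₀ a) (f : UniformlyProperChainMap X' X L φ) (i : ℤ) :
    InvMorphism (outsideHomology f.image (n - i - 1))
      (InvSystem.const ℕ (CptCohomology (⊤ : Subcomplex X') i)) (shiftDown (D₀ + 1)) where
  toFun R := E.homologyToMap f i R.2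
  comm R R' h x := by
    have hle : nbhd (R.1 - (D₀ + 1)) f.image ≤ nbhd (R'.1 - (D₀ + 1)) f.image :=
      nbhd_mono_left (Nat.sub_le_sub_right h _) _
    have h1 := E.alexander_natural (outside_anti f.image h) hle
      (E.separates_outside' f.image R'.2) (E.separates_outside' f.image R.2)
      (n - i - 1) i (by ring) x
    have h2 := f.cohomologyMap_cohRestrict (le_nbhd (R.1 - (D₀ + 1)) f.image) hle i
      (E.alexander (E.separates_outside' f.image R'.2) (n - i - 1) i (by ring) x)
    exact h2.symm.trans (congrArg _ h1.symm)

/-- The family of compositions `H̃ᵢ(X') → H̃ᵢ(N_R(K)) → H_c^{n-i-1}(Y_{R+D})`, as a morphism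
of direct systems. -/
def cohomologyMorphism (E : CoarsePD X n N D₀ a) (f : UniformlyProperChainMap X' X L φ) (i : ℤ) :
    DirMorphism (DirSystem.const ℕ (RedHomology (⊤ : Subcomplex X') i))
      (outsideCohomology f.image (n - i - 1)) (shiftUp (D₀ + 1)) where
  toFun R := E.mapToCohomology f i R.1
  comm R R' h x := by
    have h1 := E.alexander_natural (nbhd_mono_left h f.image)
      (outside_anti f.image (Nat.add_le_add_right h (D₀ + 1)))
      (E.separates_nbhd f.image R.1) (E.separates_nbhd f.image R'.1) i (n - i - 1) (by ring)
      (f.homologyMap (le_nbhd R.1 f.image) i x)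
    obtain ⟨z, hz, rfl⟩ := Subquot.exists_mk x
    exact h1.symm

end CoarsePD

end CoarseAlexander

end

open CoarseAlexander

namespace CoarseAlexander

variable {V : Type u} {V' : Type v} [LinearOrder V] [LinearOrder V']
variable {X : MetricComplex V} {X' : MetricComplex V'}

/-! ### Chains and cochains -/

/-! The duality operators `P`, `Pbar` and their homotopies move supports by at most `D₀`, so
Alexander duality between `K` and its complement holds on the chain level up to a loss of `D₀ + 1`
in the radius of the tubular neighbourhood. What remains is to compare neighbourhoods of `K` with
`X'`. This is done by a controlled coarse inverse `g` of `f`: a chain map defined on `N_R(K)` in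
degrees at most `k`, with a homotopy `H` in `X` from the inclusion to `f ∘ g` in those degrees, and
a homotopy `H'` in `X'` from the identity to `g ∘ f` in degrees below `k`
(`nonempty_coarseInverse`). All three come from one induction over simplices, `exists_homotopy`: the
value on a simplex fills a cycle already determined by its faces. Acyclicity of `X'` through degree
`k - 1` is exactly what `g` on `k`-simplices and `H'` on `(k-1)`-simplices require.

Three chain-level arguments follow. Kernel (`redIncl_eq_zero_of_homologyToMap`, `i ≤ k`): if `f*
Pbar c` is a coboundary, then `g` and `H` make `Pbar c` a coboundary `δθ` near `K`, so `c` is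
homologous to `P (Pbar c - δθ)`, up to chains far from `K`, and that chain is itself away from `K`.
Image (`mem_range_homologyToMap`, `i < k`): a cocycle `β` of `X'` comes from the boundary of `P (g*
β)`; this needs `g* β` to be a cocycle near `K`, hence `g` to be a chain map one degree higher, and
needs `H'` in degree `i`. Image in the direct system (`exists_mapToCohomology_eq`, `i ≤ k`): for a
cocycle `ψ` on `Y_R`, the boundary of `P ψ` lies near `K`, and `g` carries it to a cycle of `X'`.

Injectivity for the direct system is trivial, since the reduced homology of `X'` vanishes below
degree `k`. The last assertion is the surjectivity in degree `n`, whose source is the reduced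
homology in degree `-1` of a nonempty complex.

The constants are uniform because bounded geometry bounds the dimension of `X`: the induction over
simplices has at most `N + 1` stages, whatever `n` and `k` are. -/

lemma single_mem_chainsOn {A : Set (Simplex X)} {s : Simplex X} (hs : s ∈ A) {j : ℤ}
    (hj : (s.1.card : ℤ) = j + 1) : Finsupp.single s (1 : ℤ) ∈ chainsOn A j :=
  Finsupp.single_mem_supported ℤ _ ⟨hs, hj⟩

/-- Chains carried by `A` are spanned by the simplices of `A`. This reduces conditions on chains
(supports, degrees, chain map and homotopy identities) to single simplices. -/
lemma map_mem_of_mem_chainsIn {G : Type*} [AddCommGroup G] {A : Set (Simplex X)}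
    (h : (Simplex X →₀ ℤ) →ₗ[ℤ] G) (Q : Submodule ℤ G)
    (hs : ∀ s ∈ A, h (Finsupp.single s 1) ∈ Q) {c : Simplex X →₀ ℤ} (hc : c ∈ chainsIn A) :
    h c ∈ Q := by
  rw [chainsIn, Finsupp.supported_eq_span_single] at hc
  have : Submodule.span ℤ ((fun s => Finsupp.single s (1 : ℤ)) '' A) ≤ Q.comap h := by
    rw [Submodule.span_le]
    rintro _ ⟨s, hA, rfl⟩
    exact hs s hA
  exact this hc

lemma map_mem_of_mem_chainsOn {G : Type*} [AddCommGroup G] {A : Set (Simplex X)} {j : ℤ}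
    (h : (Simplex X →₀ ℤ) →ₗ[ℤ] G) (Q : Submodule ℤ G)
    (hs : ∀ s ∈ A, (s.1.card : ℤ) = j + 1 → h (Finsupp.single s 1) ∈ Q) {c : Simplex X →₀ ℤ}
    (hc : c ∈ chainsOn A j) : h c ∈ Q :=
  map_mem_of_mem_chainsIn h Q (fun s hs' => hs s hs'.1 hs'.2) hc

lemma eq_of_mem_chainsOn {G : Type*} [AddCommGroup G] {A : Set (Simplex X)} {j : ℤ}
    (h h' : (Simplex X →₀ ℤ) →ₗ[ℤ] G)
    (hs : ∀ s ∈ A, (s.1.card : ℤ) = j + 1 → h (Finsupp.single s 1) = h' (Finsupp.single s 1))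
    {c : Simplex X →₀ ℤ} (hc : c ∈ chainsOn A j) : h c = h' c := by
  have := map_mem_of_mem_chainsOn (h - h') ⊥
    (fun s hA hj => by rw [Submodule.mem_bot, LinearMap.sub_apply, hs s hA hj, sub_self]) hc
  rwa [Submodule.mem_bot, LinearMap.sub_apply, sub_eq_zero] at this

lemma chainsIn_mono {A B : Set (Simplex X)} (h : A ⊆ B) : chainsIn A ≤ chainsIn B :=
  Finsupp.supported_mono h

lemma mem_chainsOn_of_mem_chainsIn {A B : Set (Simplex X)} {j : ℤ} {c : Simplex X →₀ ℤ}
    (h : c ∈ chainsOn A j) (h' : c ∈ chainsIn B) : c ∈ chainsOn B j :=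
  mem_chainsOn.2 fun s hs => ⟨mem_chainsIn.1 h' s hs, (mem_chainsOn.1 h s hs).2⟩

lemma boundary_single_mem_chainsOn {A : Subcomplex X} {s : Simplex X} (hs : s ∈ A) {j : ℤ}
    (hj : (s.1.card : ℤ) = j + 2) :
    boundary X (Finsupp.single s 1) ∈ chainsOn (A : Set (Simplex X)) j :=
  boundary_mem_chainsOn (single_mem_chainsOn (A := (A : Set (Simplex X))) hs (by linarith))

lemma pairing_single (φ : Cochains X) (s : Simplex X) : pairing φ (Finsupp.single s 1) = φ s := by
  simp [pairing]

lemma pairing_sub_left (φ ψ : Cochains X) (c : Chains X) :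
    pairing (φ - ψ) c = pairing φ c - pairing ψ c := by
  have : pairing (φ - ψ) = pairing φ - pairing ψ := by
    ext s; simp [pairing]
  rw [this, LinearMap.sub_apply]

lemma pairing_eq_zero {φ : Cochains X} {c : Chains X} {A : Set (Simplex X)} (hc : c ∈ chainsIn A)
    (h : ∀ s ∈ A, φ s = 0) : pairing φ c = 0 := by
  have := map_mem_of_mem_chainsIn (pairing φ) ⊥
    (fun s hs => by rw [pairing_single, h s hs]; exact Submodule.zero_mem _) hc
  simpa using this

lemma coboundary_apply (φ : Cochains X) (s : Simplex X) :
    coboundary X φ s = pairing φ (boundary X (Finsupp.single s 1)) := transpose_apply _ _ _ _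

lemma pairing_coboundary (φ : Cochains X) (c : Chains X) :
    pairing (coboundary X φ) c = pairing φ (boundary X c) := pairing_transpose _ _ _ _

/-- The transpose of a map of degree `d` has degree `-d`. -/
lemma transpose_mem_chainsOn {g : Chains X' →ₗ[ℤ] Chains X} (hg : LocallyFiniteMap g) {d : ℤ}
    (hd : ∀ s : Simplex X', g (Finsupp.single s 1) ∈ chainsOn Set.univ ((s.1.card : ℤ) - 1 + d))
    {A : Set (Simplex X)} {j i : ℤ} (hi : i + d = j) {φ : Cochains X} (hφ : φ ∈ chainsOn A j) :
    transpose g hg φ ∈ chainsOn Set.univ i := by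
  refine mem_chainsOn.2 fun t ht => ⟨trivial, ?_⟩
  rw [transpose_apply, pairing_apply] at ht
  obtain ⟨s, hs, hne⟩ := Finset.exists_ne_zero_of_sum_ne_zero ht
  have h2 := (mem_chainsOn.1 (hd t) s (Finsupp.mem_support_iff.1 hs)).2
  have h3 := (mem_chainsOn.1 hφ s (right_ne_zero_of_mul hne)).2
  linarith

lemma coboundary_mem_chainsOn {A : Set (Simplex X)} {i j : ℤ} (hi : i + 1 = j) {φ : Cochains X}
    (hφ : φ ∈ chainsOn A i) : coboundary X φ ∈ chainsOn Set.univ j := by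
  refine transpose_mem_chainsOn (locallyFinite_boundary X) (d := -1) (fun s => ?_) (by linarith) hφ
  have := boundary_single_mem_chainsOn (A := ⊤) (s := s) LowerSet.mem_top
    (j := (s.1.card : ℤ) - 1 + -1) (by ring)
  exact chainsOn_mono (Set.subset_univ _) _ this

/-- Homogeneous cochains agree if they agree on the simplices of their degree. -/
lemma cochain_eq_of_degree {A B : Set (Simplex X)} {i : ℤ} {φ ψ : Cochains X}
    (hφ : φ ∈ chainsOn A i) (hψ : ψ ∈ chainsOn B i)
    (h : ∀ s : Simplex X, (s.1.card : ℤ) = i + 1 → φ s = ψ s) : φ = ψ := by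
  ext s
  by_cases hs : (s.1.card : ℤ) = i + 1
  · exact h s hs
  · have h1 : φ s = 0 := by
      by_contra hne
      exact hs (mem_chainsOn.1 hφ s hne).2
    have h2 : ψ s = 0 := by
      by_contra hne
      exact hs (mem_chainsOn.1 hψ s hne).2
    rw [h1, h2]

/-! ### Distances and neighbourhoods -/

lemma dist_le_one {s : Simplex X} {v w : V} (hv : v ∈ s.1) (hw : w ∈ s.1) : X.dist v w ≤ 1 := by
  rcases eq_or_ne v w with rfl | h
  · rw [X.dist_self]; exact Nat.zero_le _
  · exact (SimpleGraph.dist_eq_one_iff_adj.2 (show (edgeGraph X.toAbstractSimplicialComplex).Adj v w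
      from ⟨h, s.1, s.2, hv, hw⟩)).le

lemma exists_dist_le_of_mem_verts_nbhd {A : Subcomplex X} {d : ℕ} {v : V}
    (hv : v ∈ verts (nbhd d A)) : ∃ w ∈ verts A, X.dist v w ≤ d := by
  induction d generalizing v with
  | zero => exact ⟨v, hv, by rw [X.dist_self]⟩
  | succ d ih =>
    rw [nbhd_succ] at hv
    obtain ⟨s, ⟨t, ⟨x, hx, hxA⟩, hst⟩, hvs⟩ := hv
    obtain ⟨w, hw, hd⟩ := ih hxA
    have h1 := X.dist_triangle v x w
    have h2 := dist_le_one (hst hvs) hx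
    exact ⟨w, hw, by omega⟩

lemma mem_closedStar {A : Subcomplex X} {s : Simplex X} {v : V} (hv : v ∈ s.1)
    (hA : v ∈ verts A) : s ∈ closedStar A := subset_lowerClosure ⟨v, hv, hA⟩

/-- Each edge of a geodesic lies in a simplex meeting the preceding star. With
`exists_dist_le_of_mem_verts_nbhd` this identifies the vertices of `nbhd d A` with the metric
`d`-neighbourhood of the vertices of `A`. -/
lemma mem_verts_nbhd {A : Subcomplex X} {d : ℕ} {v w : V} (hv : v ∈ verts A)
    (h : X.dist v w ≤ d) : w ∈ verts (nbhd d A) := by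
  induction d generalizing w with
  | zero =>
    have h0 : X.dist v w = 0 := Nat.le_zero.1 h
    have := X.connected.dist_eq_zero_iff.1 h0
    exact this ▸ hv
  | succ d ih =>
    obtain ⟨p, hp⟩ := X.connected.exists_walk_length_eq_dist v w
    have hp' : p.length ≤ d + 1 := hp.trans_le h
    by_cases hnil : p.Nil
    · have := hnil.eq
      subst this
      obtain ⟨s, hs, hvs⟩ := hv
      exact ⟨s, le_nbhd _ _ hs, hvs⟩
    · obtain ⟨_, s, hs, h1, h2⟩ := p.adj_penultimate hnil
      have h3 := SimpleGraph.dist_le p.dropLast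
      rw [SimpleGraph.Walk.length_dropLast] at h3
      have h4 : p.penultimate ∈ verts (nbhd d A) := ih (show X.dist v p.penultimate ≤ d from
        h3.trans (by omega))
      rw [nbhd_succ]
      exact ⟨⟨s, hs⟩, mem_closedStar (s := ⟨s, hs⟩) h1 h4, h2⟩

/-- One more star passes from a vertex near `A` to every simplex containing it; this is the source
of the summand `1` in the later radii. -/
lemma mem_nbhd_succ {A : Subcomplex X} {d : ℕ} {v w : V} {s : Simplex X} (hv : v ∈ verts A)
    (h : X.dist v w ≤ d) (hw : w ∈ s.1) : s ∈ nbhd (d + 1) A := by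
  rw [nbhd_succ]
  exact mem_closedStar hw (mem_verts_nbhd hv h)

/-- The simplices with all vertices in the ball of radius `r` about `v`. -/
def MetricComplex.ball (X : MetricComplex V) (v : V) (r : ℕ) : Set (Simplex X) :=
  {s | ∀ w ∈ s.1, X.dist v w ≤ r}

lemma ball_subset {v w : V} {r r' : ℕ} (h : X.dist w v + r ≤ r') : X.ball v r ⊆ X.ball w r' :=
  fun s hs x hx => by
    have h1 := X.dist_triangle w v x
    have h2 := hs x hx
    omega

lemma ball_mono (v : V) {r r' : ℕ} (h : r ≤ r') : X.ball v r ⊆ X.ball v r' :=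
  ball_subset (by rw [X.dist_self]; omega)

lemma boundary_vertex {s : Simplex X} (hs : s.1.card = 1) :
    boundary X (Finsupp.single s 1) = 0 := by
  ext t
  by_contra h
  have h1 := (boundary_single s t h).2
  have h2 := Finset.card_pos.2 (simplex_nonempty t)
  omega

/-- The vertex `v`, as a simplex. -/
def MetricComplex.vertex (X : MetricComplex V) (v : V) : Simplex X := ⟨{v}, X.singleton_mem v⟩

lemma augBoundary_vertex (v : V) (m : ℤ) :
    augBoundary X (m • Finsupp.single (X.vertex v) 1, 0) = (0, m) := by
  have h : (X.vertex v).1.card = 1 := Finset.card_singleton v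
  have h1 : boundary X (m • Finsupp.single (X.vertex v) 1) = 0 := by
    rw [map_smul, boundary_vertex h, smul_zero]
  have h2 : augmentation X (m • Finsupp.single (X.vertex v) 1) = m := by
    rw [map_smul, augmentation, Finsupp.linearCombination_single, if_pos h, one_smul, smul_eq_mul,
      mul_one]
  exact Prod.ext h1 h2

/-- Cycles in a ball bound in a larger ball, in the degrees in which the complex is uniformly
acyclic. -/
lemma exists_filling {M j : ℤ} {a : ℕ → ℕ} (hX : X.UniformlyAcyclicUpTo M a) (hj : j ≤ M)
    {z : Chains X × ℤ} (hz : z ∈ redCycles (⊤ : Subcomplex X) j) (v : V) (r : ℕ)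
    (hr : z.1 ∈ chainsIn (X.ball v r)) :
    ∃ e ∈ chainsOn Set.univ (j + 1), augBoundary X (e, 0) = z ∧
      e ∈ chainsIn (X.ball v (r + a (2 * r))) := by
  rcases lt_or_ge j 0 with hneg | hpos
  · have hc : z.1 = 0 := by
      ext s
      by_contra hs
      have h1 := (mem_chainsOn.1 hz.1.1 s hs).2
      have h2 := Finset.card_pos.2 (simplex_nonempty s)
      omega
    have hm := hz.1.2
    rcases eq_or_ne j (-1) with rfl | hne
    -- In degree `-1` a cycle is an integer, and that multiple of the centre of the ball fills it.
    -- This is how the later inductions start at vertices.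
    · refine ⟨z.2 • Finsupp.single (X.vertex v) 1,
        Submodule.smul_mem _ _ (single_mem_chainsOn (Set.mem_univ _) (by simp [MetricComplex.vertex])), ?_,
        Submodule.smul_mem _ _ (Finsupp.single_mem_supported ℤ _ ?_)⟩
      · rw [augBoundary_vertex]
        exact Prod.ext hc.symm rfl
      · intro w hw
        rw [Finset.mem_singleton.1 hw, X.dist_self]
        exact Nat.zero_le _
    · rw [if_neg hne] at hm
      refine ⟨0, Submodule.zero_mem _, ?_, Submodule.zero_mem _⟩
      rw [Prod.mk_zero_zero, map_zero]
      exact Prod.ext hc.symm (Eq.symm hm)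
  · let A : Subcomplex X := lowerClosure (z.1.support : Set (Simplex X))
    have hA : ∀ x ∈ verts A, X.dist v x ≤ r := by
      rintro x ⟨s, ⟨t, ht, hst⟩, hx⟩
      exact mem_chainsIn.1 hr t (Finsupp.mem_support_iff.1 ht) x (hst hx)
    have hdiam : ediam A ≤ ((2 * r : ℕ) : ℝ≥0∞) := by
      refine iSup₂_le fun x hx => iSup₂_le fun y hy => ?_
      have h1 := X.dist_triangle x v y
      rw [X.dist_comm x v] at h1
      have h2 := hA x hx
      have h3 := hA y hy
      exact_mod_cast (show X.dist x y ≤ 2 * r by omega)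
    have hzA : z ∈ redCycles A j :=
      ⟨⟨mem_chainsOn.2 fun s hs => ⟨subset_lowerClosure (Finsupp.mem_support_iff.2 hs),
        (mem_chainsOn.1 hz.1.1 s hs).2⟩, hz.1.2⟩, hz.2⟩
    -- The function `a` need not be monotone, so it is evaluated at the bound `2 * r` itself and not
    -- at the actual diameter.
    have h := hX j hpos hj (2 * r) A hdiam (Subquot.mk _ hzA)
    obtain ⟨hn, hmk⟩ := redIncl_mk (le_nbhd (a (2 * r)) A) j _ hzA
    rw [hmk] at h
    obtain ⟨e, he, hez⟩ := (Submodule.Quotient.mk_eq_zero _).1 h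
    refine ⟨e.1, chainsOn_mono (Set.subset_univ _) _ he.1, hez, mem_chainsIn.2 fun s hs w hw => ?_⟩
    obtain ⟨x, hx, hd⟩ := exists_dist_le_of_mem_verts_nbhd
      (A := A) ⟨s, (mem_chainsOn.1 he.1 s hs).1, hw⟩
    have h1 := X.dist_triangle v x w
    rw [X.dist_comm x w] at h1
    have h2 := hA x hx
    omega

/-! ### Controlled chain maps and chain homotopies -/

/-- The radius of the values on simplices with `c` vertices of a homotopy constructed by
`exists_homotopy`. -/
def homotopyRadius (a : ℕ → ℕ) (r : ℕ) : ℕ → ℕ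
  | 0 => 0
  -- The inner `r` moves the centre from a vertex of a face to a fixed vertex of the simplex, `a` is
  -- the cost of filling in that ball, and the outer `r` moves the centre to an arbitrary vertex.
  | c + 1 => r + ((r + homotopyRadius a r c) + a (2 * (r + homotopyRadius a r c)))

lemma homotopyRadius_mono (a : ℕ → ℕ) (r : ℕ) : Monotone (homotopyRadius a r) :=
  monotone_nat_of_le_succ fun c => by
    rw [homotopyRadius]
    omega

lemma augBoundary_add_smul (c : Chains X × ℤ) (b : Chains X) (ε : ℤ) :
    augBoundary X (c + (ε • b, 0)) = augBoundary X c + ε • augBoundary X (b, 0) := by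
  rw [map_add, ← map_smul]
  simp

/-- The construction of controlled chain maps and chain homotopies, simplex by simplex. -/
lemma exists_homotopy {M e : ℤ} {a : ℕ → ℕ} (hX' : X'.UniformlyAcyclicUpTo M a) (ε : ℤ)
    (A : Subcomplex X) (q : V → V') (r : ℕ)
    (hq : ∀ s ∈ A, ∀ v ∈ s.1, ∀ w ∈ s.1, X'.dist (q v) (q w) ≤ r)
    (U : Chains X →ₗ[ℤ] Chains X' × ℤ) (m : ℕ) (hm : m + e ≤ M + 1)
    (hdeg : ∀ s ∈ A, s.1.card ≤ m →
      U (Finsupp.single s 1) ∈ augChainsOn ⊤ ((s.1.card : ℤ) - 1 + e))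
    (hcomm : ∀ s ∈ A, s.1.card ≤ m → augBoundary X' (U (Finsupp.single s 1))
      + ε • U (boundary X (Finsupp.single s 1)) = 0)
    (hU : ∀ s ∈ A, s.1.card ≤ m → ∀ v ∈ s.1,
      (U (Finsupp.single s 1)).1 ∈ chainsIn (X'.ball (q v) r)) :
    ∃ h : Chains X →ₗ[ℤ] Chains X',
      (∀ s, ¬ (s ∈ A ∧ s.1.card ≤ m) → h (Finsupp.single s 1) = 0) ∧
      (∀ s, h (Finsupp.single s 1) ∈ chainsOn Set.univ ((s.1.card : ℤ) + e)) ∧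
      (∀ s ∈ A, s.1.card ≤ m → augBoundary X' (h (Finsupp.single s 1), 0)
        = U (Finsupp.single s 1) + (ε • h (boundary X (Finsupp.single s 1)), 0)) ∧
      (∀ s ∈ A, s.1.card ≤ m → ∀ v ∈ s.1,
        h (Finsupp.single s 1) ∈ chainsIn (X'.ball (q v) (homotopyRadius a r s.1.card))) := by
  induction m with
  | zero =>
    have hpos : ∀ s : Simplex X, ¬ s.1.card ≤ 0 := fun s hs => by
      have := Finset.card_pos.2 (simplex_nonempty s)
      omega
    exact ⟨0, fun _ _ => rfl, fun _ => Submodule.zero_mem _, fun s _ hs => absurd hs (hpos s),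
      fun s _ hs => absurd hs (hpos s)⟩
  | succ m ih =>
    obtain ⟨h, h0, h1, h2, h3⟩ := ih (by push_cast at hm; linarith)
      (fun s hs hc => hdeg s hs (hc.trans (Nat.le_succ m)))
      (fun s hs hc => hcomm s hs (hc.trans (Nat.le_succ m)))
      (fun s hs hc => hU s hs (hc.trans (Nat.le_succ m)))
    -- The map `h` of the preceding stage vanishes on simplices with `m + 1` vertices; the chains
    -- `c` supply its values there and are zero elsewhere.
    have key : ∀ s : Simplex X, ∃ c ∈ chainsOn Set.univ ((s.1.card : ℤ) + e),
        (¬ (s ∈ A ∧ s.1.card = m + 1) → c = 0) ∧ (s ∈ A ∧ s.1.card = m + 1 →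
          augBoundary X' (c, 0)
            = U (Finsupp.single s 1) + (ε • h (boundary X (Finsupp.single s 1)), 0) ∧
          ∀ v ∈ s.1, c ∈ chainsIn (X'.ball (q v) (homotopyRadius a r s.1.card))) := by
      intro s
      by_cases hs : s ∈ A ∧ s.1.card = m + 1
      swap
      · exact ⟨0, Submodule.zero_mem _, fun _ => rfl, fun h => absurd h hs⟩
      obtain ⟨hsA, hcard⟩ := hs
      have hcard' : (s.1.card : ℤ) = m + 1 := by exact_mod_cast hcard
      have hbd : boundary X (Finsupp.single s 1) ∈ chainsOn (A : Set (Simplex X)) ((m : ℤ) - 1) :=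
        boundary_single_mem_chainsOn hsA (by rw [hcard']; ring)
      -- The identity for `h` on the faces, with `∂∂ = 0` removing the second-order term. Together
      -- with `hcomm` it makes the prescribed boundary a cycle.
      have hcyc : augBoundary X' (h (boundary X (Finsupp.single s 1)), 0)
          = U (boundary X (Finsupp.single s 1)) := by
        have := eq_of_mem_chainsOn (augBoundary X' ∘ₗ LinearMap.inl ℤ (Chains X') ℤ ∘ₗ h)
          (U + ε • (LinearMap.inl ℤ (Chains X') ℤ ∘ₗ h ∘ₗ boundary X)) (fun t ht hc => by
            have := h2 t ht (by have : (t.1.card : ℤ) = m := by linarith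
                                omega)
            simpa using this) hbd
        simp only [LinearMap.comp_apply, LinearMap.add_apply, LinearMap.smul_apply,
          LinearMap.inl_apply, boundary_boundary, map_zero, smul_zero, add_zero] at this
        exact this
      have hdegh : h (boundary X (Finsupp.single s 1)) ∈ chainsOn Set.univ ((m : ℤ) + e) :=
        map_mem_of_mem_chainsOn h _ (fun t _ hc => by
          have := h1 t
          rwa [hc, sub_add_cancel] at this) hbd
      have hdegU := hdeg s hsA hcard.le
      rw [hcard', add_sub_cancel_right] at hdegU
      obtain ⟨v₀, hv₀⟩ := simplex_nonempty s
      have hz : U (Finsupp.single s 1) + (ε • h (boundary X (Finsupp.single s 1)), 0)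
          ∈ redCycles (⊤ : Subcomplex X') ((m : ℤ) + e) := by
        refine ⟨Submodule.add_mem _ hdegU ⟨Submodule.smul_mem _ _ (by simpa using hdegh),
          Submodule.zero_mem _⟩, ?_⟩
        change augBoundary X' _ = 0
        rw [augBoundary_add_smul, hcyc]
        exact hcomm s hsA hcard.le
      have hball : (U (Finsupp.single s 1) + (ε • h (boundary X (Finsupp.single s 1)), (0 : ℤ))).1
          ∈ chainsIn (X'.ball (q v₀) (r + homotopyRadius a r m)) := by
        refine Submodule.add_mem _ (chainsIn_mono (ball_mono _ (Nat.le_add_right _ _))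
          (hU s hsA hcard.le v₀ hv₀)) (Submodule.smul_mem _ _ ?_)
        refine map_mem_of_mem_chainsIn (A := {t | t ≤ s ∧ t.1.card = m}) h _ (fun t ht => ?_) ?_
        · obtain ⟨v, hv⟩ := simplex_nonempty t
          have h4 := h3 t (A.lower ht.1 hsA) ht.2.le v hv
          rw [ht.2] at h4
          exact chainsIn_mono (ball_subset (Nat.add_le_add_right
            (hq s hsA v₀ hv₀ v (ht.1 hv)) _)) h4
        · refine mem_chainsIn.2 fun t ht => ?_
          have := boundary_single s t ht
          exact ⟨this.1, by omega⟩
      obtain ⟨c, hc, hcz, hcb⟩ := exists_filling hX' (by push_cast at hm; linarith) hz _ _ hball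
      refine ⟨c, by rwa [hcard', add_right_comm], fun hn => absurd ⟨hsA, hcard⟩ hn, fun _ =>
        ⟨hcz, fun v hv => ?_⟩⟩
      rw [hcard, homotopyRadius]
      exact chainsIn_mono (ball_subset (Nat.add_le_add_right (hq s hsA v hv v₀ hv₀) _)) hcb
    choose c hcdeg hc0 hc using key
    have hnew : ∀ s, (h + Finsupp.linearCombination ℤ c) (Finsupp.single s 1)
        = h (Finsupp.single s 1) + c s := fun s => by simp
    -- Faces of a simplex with at most `m + 1` vertices have at most `m` vertices, where the
    -- correction `c` is zero.
    have hbdy : ∀ s : Simplex X, s.1.card ≤ m + 1 → (h + Finsupp.linearCombination ℤ c)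
        (boundary X (Finsupp.single s 1)) = h (boundary X (Finsupp.single s 1)) := by
      intro s hs
      refine eq_of_mem_chainsOn (A := ((⊤ : Subcomplex X) : Set (Simplex X)))
        (h + Finsupp.linearCombination ℤ c) h (fun t _ ht => ?_)
        (boundary_single_mem_chainsOn LowerSet.mem_top (j := (s.1.card : ℤ) - 2) (by ring))
      rw [hnew, hc0 t (fun hcon => by omega), add_zero]
    refine ⟨h + Finsupp.linearCombination ℤ c, fun s hs => ?_, fun s => ?_, fun s hs hsm => ?_,
      fun s hs hsm v hv => ?_⟩
    · rw [hnew, h0 s fun hn => hs ⟨hn.1, hn.2.trans (Nat.le_succ m)⟩,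
        hc0 s fun hn => hs ⟨hn.1, hn.2.le⟩, add_zero]
    · rw [hnew]
      exact Submodule.add_mem _ (h1 s) (hcdeg s)
    · rw [hbdy s hsm, hnew]
      by_cases hm' : s.1.card = m + 1
      · rw [h0 s (fun hn => by omega), zero_add]
        exact (hc s ⟨hs, hm'⟩).1
      · rw [hc0 s (fun hn => hm' hn.2), add_zero]
        exact h2 s hs (by omega)
    · rw [hnew]
      by_cases hm' : s.1.card = m + 1
      · rw [h0 s (fun hn => by omega), zero_add]
        exact (hc s ⟨hs, hm'⟩).2 v hv
      · rw [hc0 s (fun hn => hm' hn.2), add_zero]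
        exact h3 s hs (by omega) v hv

/-- A map with controlled supports is locally finite. -/
lemma locallyFiniteMap_of_dist {h : Chains X →ₗ[ℤ] Chains X'} (y : V' → V) (r : ℕ)
    (H : ∀ s t, h (Finsupp.single s 1) t ≠ 0 → ∀ w ∈ t.1, ∃ v ∈ s.1, X.dist (y w) v ≤ r) :
    LocallyFiniteMap h := by
  intro t
  obtain ⟨w, hw⟩ := simplex_nonempty t
  have h1 : (⋃ v ∈ {v | X.dist (y w) v ≤ r}, {s : Simplex X | v ∈ s.1}).Finite :=
    (finite_ball X (y w) r).biUnion fun v _ => ((X.locallyFinite v).preimage (f := Subtype.val)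
      (Subtype.val_injective.injOn)).subset fun s hs => ⟨s.2, hs⟩
  refine h1.subset fun s hs => ?_
  obtain ⟨v, hv, hd⟩ := H s t hs w hw
  exact Set.mem_biUnion hd hv

/-- For a vertex `v` of `s`, the other vertices are distinct `0`-simplices of the link of `v`. The
resulting dimension bound makes `homotopyRadius` at `N + 1` a uniform bound for all simplices of
`X`. -/
lemma card_le_of_boundedGeometry {N : ℕ} (hX : X.BoundedGeometry N) (s : Simplex X) :
    s.1.card ≤ N + 1 := by
  obtain ⟨v, hv⟩ := simplex_nonempty s
  have h1 := hX (X.vertex v)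
  have h2 : ((s.1.erase v : Finset V) : Set V).encard
      ≤ {t : Simplex X | Disjoint (X.vertex v).1 t.1 ∧ (X.vertex v).1 ∪ t.1 ∈ X.faces}.encard := by
    rw [← Function.Injective.encard_image (f := X.vertex)
      (fun x y hxy => Finset.singleton_injective (congrArg Subtype.val hxy))]
    refine Set.encard_le_encard ?_
    rintro _ ⟨w, hw, rfl⟩
    have hw' := Finset.mem_erase.1 (Finset.mem_coe.1 hw)
    refine ⟨Finset.disjoint_singleton.2 hw'.1.symm, (X.isRelLowerSet_faces s.2).2 ?_ ?_⟩
    · intro x hx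
      rcases Finset.mem_union.1 hx with hx | hx
      · rw [Finset.mem_singleton.1 hx]; exact hv
      · rw [Finset.mem_singleton.1 hx]; exact hw'.2
    · exact ⟨v, Finset.mem_union_left _ (Finset.mem_singleton_self v)⟩
  have h3 := h2.trans h1
  rw [Set.encard_coe_eq_coe_finsetCard, Finset.card_erase_of_mem hv] at h3
  have h4 : s.1.card - 1 ≤ N := by exact_mod_cast h3
  omega

/-! ### Coarse inverses of uniformly proper chain maps -/

lemma imageSupport_mono (h : Chains X' →ₗ[ℤ] Chains X) {A B : Subcomplex X'} (hAB : A ≤ B) :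
    imageSupport h A ≤ imageSupport h B :=
  lowerClosure_mono fun _ ⟨c, hc, ht⟩ => ⟨c, chainsIn_mono hAB hc, ht⟩

lemma mem_imageSupport {h : Chains X' →ₗ[ℤ] Chains X} {A : Subcomplex X'} {s : Simplex X'}
    (hs : s ∈ A) {t : Simplex X} (ht : h (Finsupp.single s 1) t ≠ 0) : t ∈ imageSupport h A :=
  subset_lowerClosure ⟨_, Finsupp.single_mem_supported ℤ _ hs, ht⟩

/-- A number `m` with `φ m > r`, if there is one. -/
noncomputable def properRadius (φ : ℝ≥0 → ℝ≥0) (r : ℕ) : ℕ :=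
  Classical.epsilon fun m : ℕ => (r : ℝ≥0) < φ m

namespace UniformlyProperChainMap

variable {L : ℕ} {φ : ℝ≥0 → ℝ≥0} (f : UniformlyProperChainMap X' X L φ)

/-- Since `f` preserves augmentations, the image of a vertex has augmentation `1`, so it is not the
zero chain. -/
lemma exists_vertex_image (w : V') :
    ∃ v, v ∈ verts (imageSupport f.toLin (LowerSet.Iic (X'.vertex w))) := by
  have h1 : augmentation X (f.toLin (Finsupp.single (X'.vertex w) 1)) = 1 := by
    rw [f.augmentation_comp, augmentation, Finsupp.linearCombination_single,
      if_pos (show (X'.vertex w).1.card = 1 from Finset.card_singleton w), one_smul]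
  obtain ⟨t, ht⟩ : ∃ t, f.toLin (Finsupp.single (X'.vertex w) 1) t ≠ 0 := by
    by_contra! hcon
    rw [show f.toLin (Finsupp.single (X'.vertex w) 1) = 0 from Finsupp.ext hcon, map_zero] at h1
    exact zero_ne_one h1
  obtain ⟨v, hv⟩ := simplex_nonempty t
  exact ⟨v, t, mem_imageSupport (LowerSet.mem_Iic_iff.2 le_rfl) ht, hv⟩

/-- A map of vertices close to `f`. -/
noncomputable def vertexMap (w : V') : V := (f.exists_vertex_image w).choose

lemma vertexMap_mem {A : Subcomplex X'} {w : V'} (hw : w ∈ verts A) :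
    f.vertexMap w ∈ verts (imageSupport f.toLin A) := by
  obtain ⟨s, hs, hws⟩ := hw
  obtain ⟨t, ht, hv⟩ := (f.exists_vertex_image w).choose_spec
  exact ⟨t, imageSupport_mono _ (LowerSet.Iic_le.2
    (A.lower (Finset.singleton_subset_iff.2 hws : X'.vertex w ≤ s) hs)) ht, hv⟩

lemma dist_vertexMap_le {s : Simplex X'} {w : V'} (hw : w ∈ s.1) {v : V}
    (hv : v ∈ verts (imageSupport f.toLin (LowerSet.Iic s))) : X.dist (f.vertexMap w) v ≤ L :=
  dist_le_of_ediam_le (f.lipschitz s)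
    (f.vertexMap_mem ⟨s, LowerSet.mem_Iic_iff.2 le_rfl, hw⟩) hv

lemma dist_vertexMap_le' {s : Simplex X'} {t : Simplex X} (h : f.toLin (Finsupp.single s 1) t ≠ 0)
    {w : V'} (hw : w ∈ s.1) {v : V} (hv : v ∈ t.1) : X.dist (f.vertexMap w) v ≤ L :=
  f.dist_vertexMap_le hw ⟨t, mem_imageSupport (LowerSet.mem_Iic_iff.2 le_rfl) h, hv⟩

/-- Adjacent vertices span a common simplex, whose image has support of diameter at most `L`; sum
along a geodesic. -/
lemma vertexMap_lipschitz (w w' : V') :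
    X.dist (f.vertexMap w) (f.vertexMap w') ≤ L * X'.dist w w' := by
  obtain ⟨p, hp⟩ := X'.connected.exists_walk_length_eq_dist w w'
  have key : ∀ {x y : V'} (p : (edgeGraph X'.toAbstractSimplicialComplex).Walk x y),
      X.dist (f.vertexMap x) (f.vertexMap y) ≤ L * p.length := by
    intro x y p
    induction p with
    | nil => rw [X.dist_self]; exact Nat.zero_le _
    | @cons x y z hxy p ih =>
      have hadj := hxy
      obtain ⟨_, s, hs, hx, hy⟩ := hadj
      have h1 := f.dist_vertexMap_le (s := ⟨s, hs⟩) hx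
        (f.vertexMap_mem ⟨⟨s, hs⟩, LowerSet.mem_Iic_iff.2 le_rfl, hy⟩)
      have h2 := X.dist_triangle (f.vertexMap x) (f.vertexMap y) (f.vertexMap z)
      rw [SimpleGraph.Walk.length_cons, Nat.mul_succ]
      omega
  have := key p
  rwa [hp] at this

/-- Properness of `f` on vertices. The support of the image of `{w, w'}` lies within `L` of the two
image vertices, so its diameter is at most `r + 2 * L`; a larger distance in `X'` would contradict
the distortion bound at `m`. Monotonicity of `φ` is not needed, as the bound is applied at `m`
itself. -/
lemma dist_le_of_dist_vertexMap_le {w w' : V'} {r : ℕ}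
    (h : X.dist (f.vertexMap w) (f.vertexMap w') ≤ r) :
    X'.dist w w' ≤ properRadius φ (r + 2 * L) := by
  have hex : ∃ m : ℕ, ((r + 2 * L : ℕ) : ℝ≥0) < φ m :=
    ((f.proper.comp tendsto_natCast_atTop_atTop).eventually_gt_atTop _).exists
  have hm : ((r + 2 * L : ℕ) : ℝ≥0) < φ (properRadius φ (r + 2 * L)) :=
    Classical.epsilon_spec hex
  set m := properRadius φ (r + 2 * L)
  by_contra! hcon
  let A : Subcomplex X' := LowerSet.Iic (X'.vertex w) ⊔ LowerSet.Iic (X'.vertex w')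
  have hw : w ∈ verts A :=
    ⟨X'.vertex w, Or.inl (LowerSet.mem_Iic_iff.2 le_rfl), Finset.mem_singleton_self w⟩
  have hw' : w' ∈ verts A :=
    ⟨X'.vertex w', Or.inr (LowerSet.mem_Iic_iff.2 le_rfl), Finset.mem_singleton_self w'⟩
  have hA : ((m : ℝ≥0) : ℝ≥0∞) ≤ ediam A := by
    refine le_trans ?_ ((le_iSup₂ (f := fun y (_ : y ∈ verts A) => (X'.dist w y : ℝ≥0∞)) w' hw').trans
      (le_iSup₂ (f := fun x (_ : x ∈ verts A) => ⨆ y ∈ verts A, (X'.dist x y : ℝ≥0∞)) w hw))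
    exact_mod_cast hcon.le
  have hclose : ∀ x ∈ verts (imageSupport f.toLin A),
      X.dist (f.vertexMap w) x ≤ L ∨ X.dist (f.vertexMap w') x ≤ L := by
    rintro x ⟨y, ⟨z, ⟨c, hc, hcz⟩, hyz⟩, hx⟩
    obtain ⟨q, hq, hzq⟩ := exists_single hc hcz
    rcases hq with hq | hq
    · exact Or.inl (f.dist_vertexMap_le (Finset.mem_singleton_self w)
        ⟨z, imageSupport_mono _ (LowerSet.Iic_le.2 hq) hzq, hyz hx⟩)
    · exact Or.inr (f.dist_vertexMap_le (Finset.mem_singleton_self w')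
        ⟨z, imageSupport_mono _ (LowerSet.Iic_le.2 hq) hzq, hyz hx⟩)
  have hub : ediam (imageSupport f.toLin A) ≤ ((r + 2 * L : ℕ) : ℝ≥0∞) := by
    refine iSup₂_le fun x hx => iSup₂_le fun y hy => ?_
    have hxy : X.dist x y ≤ r + 2 * L := by
      have h1 := X.dist_triangle x (f.vertexMap w) y
      have h2 := X.dist_triangle x (f.vertexMap w') y
      have h3 := X.dist_triangle (f.vertexMap w) (f.vertexMap w') y
      have h4 := X.dist_triangle (f.vertexMap w') (f.vertexMap w) y
      rw [X.dist_comm x (f.vertexMap w)] at h1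
      rw [X.dist_comm x (f.vertexMap w')] at h2
      rw [X.dist_comm (f.vertexMap w') (f.vertexMap w)] at h4
      rcases hclose x hx with hx | hx <;> rcases hclose y hy with hy | hy <;> omega
    exact_mod_cast hxy
  have h4 := (f.distortion m A hA).trans hub
  have h5 : φ m ≤ ((r + 2 * L : ℕ) : ℝ≥0) := by exact_mod_cast h4
  exact absurd hm (not_lt.2 h5)

lemma exists_dist_vertexMap_le {R : ℕ} {v : V} (hv : v ∈ verts (nbhd R f.image)) :
    ∃ w, X.dist v (f.vertexMap w) ≤ R + L := by
  obtain ⟨x, ⟨y, ⟨z, ⟨c, hc, hcz⟩, hyz⟩, hx⟩, hd⟩ := exists_dist_le_of_mem_verts_nbhd hv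
  obtain ⟨q, hq, hzq⟩ := exists_single hc hcz
  obtain ⟨w, hw⟩ := simplex_nonempty q
  have h1 := f.dist_vertexMap_le hw ⟨z, hzq, hyz hx⟩
  have h2 := X.dist_triangle v x (f.vertexMap w)
  rw [X.dist_comm x] at h2
  exact ⟨w, by omega⟩

end UniformlyProperChainMap

/-- A chain map `g` in degrees at most `k`, defined on the `R`-neighbourhood of the image `K` of `f`
and with values within distance `r` (measured in `X`), together with a homotopy `H` from the
inclusion of the `R`-neighbourhood into the `S`-neighbourhood of `K` to `f ∘ g` in degrees at most
`k`, and a homotopy `H'` from the identity to `g ∘ f` in degrees below `k`. -/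
structure CoarseInverse {L : ℕ} {φ : ℝ≥0 → ℝ≥0} (f : UniformlyProperChainMap X' X L φ)
    (k R r S : ℕ) where
  g : Chains X →ₗ[ℤ] Chains X'
  H : Chains X →ₗ[ℤ] Chains X
  H' : Chains X' →ₗ[ℤ] Chains X'
  g_locallyFinite : LocallyFiniteMap g
  H_locallyFinite : LocallyFiniteMap H
  H'_locallyFinite : LocallyFiniteMap H'
  g_eq_zero : ∀ s, s ∉ nbhd R f.image → g (Finsupp.single s 1) = 0
  g_degree : ∀ s, g (Finsupp.single s 1) ∈ chainsOn Set.univ ((s.1.card : ℤ) - 1)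
  g_comm : ∀ s ∈ nbhd R f.image, s.1.card ≤ k + 1 →
    boundary X' (g (Finsupp.single s 1)) = g (boundary X (Finsupp.single s 1))
  g_augmentation : ∀ s ∈ nbhd R f.image, s.1.card ≤ k + 1 →
    augmentation X' (g (Finsupp.single s 1)) = augmentation X (Finsupp.single s 1)
  g_dist : ∀ s t, g (Finsupp.single s 1) t ≠ 0 → ∀ v ∈ s.1, ∀ w ∈ t.1,
    X.dist v (f.vertexMap w) ≤ r
  H_degree : ∀ s, H (Finsupp.single s 1) ∈ chainsOn Set.univ (s.1.card : ℤ)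
  H_mem : ∀ s, H (Finsupp.single s 1) ∈ chainsIn (nbhd S f.image : Set (Simplex X))
  H_comm : ∀ s ∈ nbhd R f.image, s.1.card ≤ k + 1 → boundary X (H (Finsupp.single s 1))
    + H (boundary X (Finsupp.single s 1)) = f.toLin (g (Finsupp.single s 1)) - Finsupp.single s 1
  H_augmentation : ∀ s, augmentation X (H (Finsupp.single s 1)) = 0
  H'_degree : ∀ s, H' (Finsupp.single s 1) ∈ chainsOn Set.univ (s.1.card : ℤ)
  H'_comm : ∀ s : Simplex X', s.1.card ≤ k → boundary X' (H' (Finsupp.single s 1))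
    + H' (boundary X' (Finsupp.single s 1)) = g (f.toLin (Finsupp.single s 1)) - Finsupp.single s 1

/-- The displacement of the coarse inverse on the `R`-neighbourhood. -/
noncomputable def inverseRadius (N L : ℕ) (a' : ℕ → ℕ) (φ : ℝ≥0 → ℝ≥0) (R : ℕ) : ℕ :=
  -- Adjacent vertices of `N_R(K)` are assigned vertices of `X'` whose images under `vertexMap` are
  -- at most `2 * (R + L) + 1` apart; the last `2 * L` is the loss in
  -- `dist_le_of_dist_vertexMap_le`. At most `N + 1` stages occur.
  homotopyRadius a' (properRadius φ (2 * R + 2 * L + 1 + 2 * L)) (N + 1)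

/-- The displacement of the composition of the coarse inverse and the vertex map. -/
noncomputable def returnRadius (N L : ℕ) (a' : ℕ → ℕ) (φ : ℝ≥0 → ℝ≥0) (R : ℕ) : ℕ :=
  -- A vertex of `N_R(K)` is within `R + L` of the image of its assigned vertex; the spread of `g`
  -- is then transported to `X` by the Lipschitz bound.
  R + L + L * inverseRadius N L a' φ R

/-- The neighbourhood containing the homotopies. -/
noncomputable def trackRadius (N L : ℕ) (a a' : ℕ → ℕ) (φ : ℝ≥0 → ℝ≥0) (R : ℕ) : ℕ :=
  -- The chain `f (g s) - s` lies within `returnRadius + L + 1` of the vertices of `s`. The extra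
  -- `1` is the star of `mem_nbhd_succ`, and `R` is the radius of the neighbourhood containing `s`.
  homotopyRadius a (returnRadius N L a' φ R + L + 1) (N + 1) + 1 + R

lemma augmentation_eq_zero {j : ℤ} (hj : j ≠ 0) {c : Chains X} (hc : c ∈ chainsOn Set.univ j) :
    augmentation X c = 0 := by
  refine eq_of_mem_chainsOn (augmentation X) 0 (fun s _ hs => ?_) hc
  rw [augmentation, Finsupp.linearCombination_single, if_neg (fun h => hj (by
    rw [h] at hs; push_cast at hs; linarith)), smul_zero, LinearMap.zero_apply]

lemma inl_mem_augChainsOn_top {c : Chains X} {j : ℤ} (h : c ∈ chainsOn Set.univ j) :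
    (c, (0 : ℤ)) ∈ augChainsOn (⊤ : Subcomplex X) j :=
  ⟨by simpa using h, Submodule.zero_mem _⟩

lemma augBoundary_inl_add_neg_smul {c b : Chains X} (h : boundary X c = b)
    (h' : augmentation X c = 0) :
    augBoundary X (c, 0) + (-1 : ℤ) • ((b, 0) : Chains X × ℤ) = 0 := by
  have h0 : augBoundary X (c, 0) = (boundary X c, augmentation X c) := rfl
  rw [h0, h, h', neg_one_smul, add_neg_cancel]

lemma boundary_eq_of_augBoundary {c b x : Chains X} {m : ℤ}
    (h : augBoundary X (c, 0) = (b, m) + ((-1 : ℤ) • x, 0)) : boundary X c + x = b := by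
  have h1 : boundary X c = b + (-1 : ℤ) • x := congrArg Prod.fst h
  rw [h1, neg_one_smul, neg_add_cancel_right]

/-- A controlled chain map which vanishes in degree `-1` is controlled null-homotopic. -/
lemma exists_nullHomotopy {M : ℤ} {a : ℕ → ℕ} (hX' : X'.UniformlyAcyclicUpTo M a)
    (A : Subcomplex X) (q : V → V') (r : ℕ)
    (hq : ∀ s ∈ A, ∀ v ∈ s.1, ∀ w ∈ s.1, X'.dist (q v) (q w) ≤ r)
    (F : Chains X →ₗ[ℤ] Chains X') (m : ℕ) (hm : m ≤ M + 1)
    (hdeg : ∀ s ∈ A, s.1.card ≤ m →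
      F (Finsupp.single s 1) ∈ chainsOn Set.univ ((s.1.card : ℤ) - 1))
    (hcomm : ∀ s ∈ A, s.1.card ≤ m → boundary X' (F (Finsupp.single s 1))
      = F (boundary X (Finsupp.single s 1)))
    (haug : ∀ s ∈ A, s.1.card ≤ m → augmentation X' (F (Finsupp.single s 1)) = 0)
    (hF : ∀ s ∈ A, s.1.card ≤ m → ∀ v ∈ s.1,
      F (Finsupp.single s 1) ∈ chainsIn (X'.ball (q v) r)) :
    ∃ h : Chains X →ₗ[ℤ] Chains X',
      (∀ s, ¬ (s ∈ A ∧ s.1.card ≤ m) → h (Finsupp.single s 1) = 0) ∧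
      (∀ s, h (Finsupp.single s 1) ∈ chainsOn Set.univ (s.1.card : ℤ)) ∧
      (∀ s ∈ A, s.1.card ≤ m → boundary X' (h (Finsupp.single s 1))
        + h (boundary X (Finsupp.single s 1)) = F (Finsupp.single s 1)) ∧
      (∀ s ∈ A, s.1.card ≤ m → ∀ v ∈ s.1,
        h (Finsupp.single s 1) ∈ chainsIn (X'.ball (q v) (homotopyRadius a r s.1.card))) := by
  obtain ⟨h, h0, hd, hc, hb⟩ := exists_homotopy (e := 0) hX' (-1) A q r hq
    (LinearMap.inl ℤ (Chains X') ℤ ∘ₗ F) m (by linarith)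
    (fun s hs hm => by
      rw [add_zero]
      exact inl_mem_augChainsOn_top (hdeg s hs hm))
    (fun s hs hm => augBoundary_inl_add_neg_smul (hcomm s hs hm) (haug s hs hm)) hF
  exact ⟨h, h0, fun s => by simpa using hd s,
    fun s hs hm => boundary_eq_of_augBoundary (hc s hs hm), hb⟩

/-- Vertices of `N_R(K)` are sent to vertices of `X'` with nearby image; properness of `f` bounds
the spread of this assignment over a simplex. Filling in `X'` extends it to `g`, filling in `X`
gives `H`, and filling in `X'` again gives `H'`. No displacement constant for `g` or `H` involves
`k`. -/
theorem nonempty_coarseInverse {N L k : ℕ} {a a' : ℕ → ℕ} {φ : ℝ≥0 → ℝ≥0}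
    (hN : X.BoundedGeometry N) (hX : X.UniformlyAcyclic a)
    (hX' : X'.UniformlyAcyclicUpTo ((k : ℤ) - 1) a') (f : UniformlyProperChainMap X' X L φ)
    (R : ℕ) : Nonempty (CoarseInverse f k R (returnRadius N L a' φ R)
      (trackRadius N L a a' φ R)) := by
  set A := nbhd R f.image with hA
  obtain ⟨w₀⟩ := X'.connected.nonempty
  have hp : ∀ v, ∃ w, v ∈ verts A → X.dist v (f.vertexMap w) ≤ R + L := by
    intro v
    by_cases hv : v ∈ verts A
    · obtain ⟨w, hw⟩ := f.exists_dist_vertexMap_le hv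
      exact ⟨w, fun _ => hw⟩
    · exact ⟨w₀, fun h => absurd h hv⟩
  choose p hp using hp
  have hpq : ∀ s ∈ A, ∀ v ∈ s.1, ∀ w ∈ s.1,
      X'.dist (p v) (p w) ≤ properRadius φ (2 * R + 2 * L + 1 + 2 * L) := by
    intro s hs v hv w hw
    refine f.dist_le_of_dist_vertexMap_le ?_
    have h1 := hp v ⟨s, hs, hv⟩
    have h2 := hp w ⟨s, hs, hw⟩
    have h3 := X.dist_triangle (f.vertexMap (p v)) v (f.vertexMap (p w))
    have h4 := X.dist_triangle v w (f.vertexMap (p w))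
    have h5 := dist_le_one hv hw
    rw [X.dist_comm (f.vertexMap (p v)) v] at h3
    omega
  -- With shift `-1`, sign `1` and the augmentation as prescribed term, the general construction
  -- yields an augmentation preserving chain map. The cycles filled have degree at most `k - 1`,
  -- exactly the range available in `X'`.
  obtain ⟨g, g0, gdeg, gcomm, gball⟩ := exists_homotopy (e := -1) hX' 1 A p
    (properRadius φ (2 * R + 2 * L + 1 + 2 * L)) hpq
    (LinearMap.inr ℤ (Chains X') ℤ ∘ₗ augmentation X) (k + 1) (by push_cast; linarith)
    (fun s hs _ => by
      refine ⟨Submodule.zero_mem _, ?_⟩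
      split_ifs with h
      · trivial
      · exact augmentation_eq_zero (j := (s.1.card : ℤ) - 1) (fun h0 => h (by rw [h0]; ring))
          (single_mem_chainsOn (Set.mem_univ _) (by ring)))
    (fun s _ _ => by
      simp only [LinearMap.comp_apply, augmentation_boundary, map_zero, smul_zero, add_zero]
      rw [augBoundary_eq]
      exact map_zero (augBoundary X'))
    (fun s _ _ v _ => Submodule.zero_mem _)
  have gcomm1 : ∀ s ∈ A, s.1.card ≤ k + 1 →
      boundary X' (g (Finsupp.single s 1)) = g (boundary X (Finsupp.single s 1)) := by
    intro s hs hc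
    have := congrArg Prod.fst (gcomm s hs hc)
    rw [one_smul] at this
    exact this.trans (zero_add _)
  have gaug : ∀ s ∈ A, s.1.card ≤ k + 1 →
      augmentation X' (g (Finsupp.single s 1)) = augmentation X (Finsupp.single s 1) := by
    intro s hs hc
    exact (congrArg Prod.snd (gcomm s hs hc)).trans (add_zero _)
  have gdeg' : ∀ s, g (Finsupp.single s 1) ∈ chainsOn Set.univ ((s.1.card : ℤ) - 1) := gdeg
  have gsupp : ∀ s t, g (Finsupp.single s 1) t ≠ 0 → s ∈ A ∧ s.1.card ≤ k + 1 := by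
    intro s t ht
    by_contra hcon
    rw [g0 s hcon] at ht
    exact ht rfl
  have gp : ∀ s t, g (Finsupp.single s 1) t ≠ 0 → ∀ v ∈ s.1, ∀ w ∈ t.1,
      X'.dist (p v) w ≤ inverseRadius N L a' φ R := by
    intro s t ht v hv w hw
    obtain ⟨hsA, hc⟩ := gsupp s t ht
    exact (mem_chainsIn.1 (gball s hsA hc v hv) t ht w hw).trans
      (homotopyRadius_mono _ _ (card_le_of_boundedGeometry hN s))
  have gdist : ∀ s t, g (Finsupp.single s 1) t ≠ 0 → ∀ v ∈ s.1, ∀ w ∈ t.1,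
      X.dist v (f.vertexMap w) ≤ returnRadius N L a' φ R := by
    intro s t ht v hv w hw
    have h1 := Nat.mul_le_mul_left L (gp s t ht v hv w hw)
    have h2 := f.vertexMap_lipschitz (p v) w
    have h3 := hp v ⟨s, (gsupp s t ht).1, hv⟩
    have h4 := X.dist_triangle v (f.vertexMap (p v)) (f.vertexMap w)
    rw [returnRadius]
    omega
  have glf : LocallyFiniteMap g :=
    locallyFiniteMap_of_dist f.vertexMap (returnRadius N L a' φ R) fun s t ht w hw => by
      obtain ⟨v, hv⟩ := simplex_nonempty s
      exact ⟨v, hv, by rw [X.dist_comm]; exact gdist s t ht v hv w hw⟩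
  have fdeg : ∀ {j : ℤ} {c : Chains X'}, c ∈ chainsOn Set.univ j →
      f.toLin c ∈ chainsOn Set.univ j := fun hc => f.degree _ _ hc
  have gdegc : ∀ {j : ℤ} {c : Chains X}, c ∈ chainsOn Set.univ j →
      g c ∈ chainsOn Set.univ j := fun {j} c hc => map_mem_of_mem_chainsOn g _
    (fun s _ hs => by
      have := gdeg' s
      rwa [hs, add_sub_cancel_right] at this) hc
  have sdeg : ∀ s : Simplex X, Finsupp.single s (1 : ℤ) ∈ chainsOn Set.univ ((s.1.card : ℤ) - 1) :=
    fun s => single_mem_chainsOn (Set.mem_univ _) (by ring)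
  have sdeg' : ∀ s : Simplex X', Finsupp.single s (1 : ℤ) ∈
    chainsOn Set.univ ((s.1.card : ℤ) - 1) := fun s => single_mem_chainsOn (Set.mem_univ _) (by ring)
  -- Here the target is `X` itself, acyclic in all degrees, so the homotopy reaches the whole range
  -- of degrees in which `g` is a chain map.
  obtain ⟨H, H0, Hdeg, Hcomm, Hball⟩ := exists_nullHomotopy (M := k) (a := a)
    (X := X) (X' := X) (fun j hj _ => hX j hj) A id (returnRadius N L a' φ R + L + 1)
    (fun s _ v hv w hw => (dist_le_one hv hw).trans (by omega))
    (f.toLin ∘ₗ g - LinearMap.id) (k + 1) (by push_cast; linarith)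
    (fun s _ _ => Submodule.sub_mem _ (fdeg (gdeg' s)) (sdeg s))
    (fun s hs hc => by
      simp only [LinearMap.sub_apply, LinearMap.comp_apply, LinearMap.id_apply]
      rw [map_sub, ← f.comm, gcomm1 s hs hc])
    (fun s hs hc => by
      simp only [LinearMap.sub_apply, LinearMap.comp_apply, LinearMap.id_apply]
      rw [map_sub, f.augmentation_comp, gaug s hs hc, sub_self])
    (fun s hs hc v hv => by
      refine Submodule.sub_mem _ ?_ (Finsupp.single_mem_supported ℤ _ fun w hw =>
        (dist_le_one hv hw).trans (by omega))
      refine mem_chainsIn.2 fun t ht x hx => ?_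
      obtain ⟨t', ht', htt⟩ := apply_ne_zero f.toLin (g (Finsupp.single s 1)) t ht
      obtain ⟨w, hw⟩ := simplex_nonempty t'
      have h1 := gdist s t' ht' v hv w hw
      have h2 := f.dist_vertexMap_le' htt hw hx
      have h3 := X.dist_triangle v (f.vertexMap w) x
      change X.dist v x ≤ _
      omega)
  have Hsupp : ∀ s t, H (Finsupp.single s 1) t ≠ 0 → s ∈ A ∧ s.1.card ≤ k + 1 := by
    intro s t ht
    by_contra hcon
    rw [H0 s hcon] at ht
    exact ht rfl
  have Hdist : ∀ s t, H (Finsupp.single s 1) t ≠ 0 → ∀ v ∈ s.1, ∀ w ∈ t.1, X.dist v w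
      ≤ homotopyRadius a (returnRadius N L a' φ R + L + 1) (N + 1) := by
    intro s t ht v hv w hw
    obtain ⟨hsA, hc⟩ := Hsupp s t ht
    exact (mem_chainsIn.1 (Hball s hsA hc v hv) t ht w hw).trans
      (homotopyRadius_mono _ _ (card_le_of_boundedGeometry hN s))
  have fA : ∀ s : Simplex X', f.toLin (Finsupp.single s 1) ∈ chainsOn (A : Set (Simplex X))
      ((s.1.card : ℤ) - 1) := fun s => mem_chainsOn_of_mem_chainsIn (fdeg (sdeg' s))
        (f.apply_mem_chainsIn (le_nbhd R f.image) _)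
  have hle : ∀ s : Simplex X', s.1.card ≤ k → ∀ t : Simplex X,
      (t.1.card : ℤ) = (s.1.card : ℤ) - 1 + 1 → t.1.card ≤ k + 1 := fun s hs t ht => by omega
  -- The homotopy raises degrees by one, so the bound `k - 1` on the acyclicity of `X'` allows only
  -- simplices with at most `k` vertices. For `v` in `s` and `x` in the support of `f s`, the images
  -- of `v` and `p x` are at most `L + (R + L)` apart, which explains the argument of
  -- `properRadius`.
  obtain ⟨H', H'0, H'deg, H'comm, H'ball⟩ := exists_nullHomotopy (X := X') hX' ⊤ id
    (properRadius φ (R + 2 * L + 2 * L) + inverseRadius N L a' φ R + 1)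
    (fun s _ v hv w hw => (dist_le_one hv hw).trans (by omega))
    (g ∘ₗ f.toLin - LinearMap.id) k (by linarith)
    (fun s _ _ => Submodule.sub_mem _ (gdegc (fdeg (sdeg' s))) (sdeg' s))
    (fun s _ hc => by
      have h1 : boundary X' (g (f.toLin (Finsupp.single s 1)))
          = g (boundary X (f.toLin (Finsupp.single s 1))) :=
        eq_of_mem_chainsOn (boundary X' ∘ₗ g) (g ∘ₗ boundary X)
          (fun t ht htc => gcomm1 t ht (hle s hc t htc)) (fA s)
      simp only [LinearMap.sub_apply, LinearMap.comp_apply, LinearMap.id_apply]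
      rw [map_sub, h1, f.comm])
    (fun s _ hc => by
      have h2 : augmentation X' (g (f.toLin (Finsupp.single s 1)))
          = augmentation X (f.toLin (Finsupp.single s 1)) :=
        eq_of_mem_chainsOn (augmentation X' ∘ₗ g) (augmentation X)
          (fun t ht htc => gaug t ht (hle s hc t htc)) (fA s)
      simp only [LinearMap.sub_apply, LinearMap.comp_apply, LinearMap.id_apply]
      rw [map_sub, h2, f.augmentation_comp, sub_self])
    (fun s hs hc v hv => by
      refine Submodule.sub_mem _ ?_ (Finsupp.single_mem_supported ℤ _ fun w hw =>
        (dist_le_one hv hw).trans (by omega))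
      refine mem_chainsIn.2 fun t ht w hw => ?_
      obtain ⟨t', ht', htt⟩ := apply_ne_zero g (f.toLin (Finsupp.single s 1)) t ht
      obtain ⟨x, hx⟩ := simplex_nonempty t'
      have h1 := gp t' t htt x hx w hw
      have h2 := f.dist_vertexMap_le' ht' hv hx
      have h3 := hp x ⟨t', (gsupp t' t htt).1, hx⟩
      have h4 := X.dist_triangle (f.vertexMap v) x (f.vertexMap (p x))
      have h5 := f.dist_le_of_dist_vertexMap_le (w := v) (w' := p x) (r := R + 2 * L) (by omega)
      have h6 := X'.dist_triangle v (p x) w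
      change X'.dist v w ≤ _
      omega)
  refine ⟨⟨g, H, H', glf, ?_, ?_, fun s hs => g0 s fun h => hs h.1, gdeg', gcomm1, gaug, gdist,
    ?_, ?_, ?_, ?_, ?_, ?_⟩⟩
  · refine locallyFiniteMap_of_dist id
      (homotopyRadius a (returnRadius N L a' φ R + L + 1) (N + 1)) fun s t ht w hw => ?_
    obtain ⟨v, hv⟩ := simplex_nonempty s
    exact ⟨v, hv, by rw [X.dist_comm]; exact Hdist s t ht v hv w hw⟩
  -- Only local finiteness of `H'` is needed later, to transpose it, so here the radius may depend
  -- on `k`.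
  · refine locallyFiniteMap_of_dist id (homotopyRadius a'
      (properRadius φ (R + 2 * L + 2 * L) + inverseRadius N L a' φ R + 1) k)
      fun s t ht w hw => ?_
    obtain ⟨v, hv⟩ := simplex_nonempty s
    have hs : s.1.card ≤ k := by
      by_contra hcon
      rw [H'0 s fun h => hcon h.2] at ht
      exact ht rfl
    refine ⟨v, hv, ?_⟩
    rw [X'.dist_comm]
    exact (mem_chainsIn.1 (H'ball s LowerSet.mem_top hs v hv) t ht w hw).trans
      (homotopyRadius_mono _ _ hs)
  · exact Hdeg
  · intro s
    refine mem_chainsIn.2 fun t ht => ?_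
    obtain ⟨v, hv⟩ := simplex_nonempty s
    obtain ⟨w, hw⟩ := simplex_nonempty t
    have h1 := mem_nbhd_succ (A := A) ⟨s, (Hsupp s t ht).1, hv⟩ (Hdist s t ht v hv w hw) hw
    rwa [hA, nbhd_nbhd] at h1
  · intro s hs hc
    exact Hcomm s hs hc
  · intro s
    have h1 := Finset.card_pos.2 (simplex_nonempty s)
    exact augmentation_eq_zero (by omega) (Hdeg s)
  · exact H'deg
  · intro s hc
    exact H'comm s LowerSet.mem_top hc

/-! ### Coarse Alexander duality -/

lemma DisplacementLE.apply_mem {h : (Simplex X →₀ ℤ) →ₗ[ℤ] (Simplex X →₀ ℤ)} {d : ℕ}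
    (hd : DisplacementLE h d) {B : Subcomplex X} {c : Simplex X →₀ ℤ}
    (hc : c ∈ chainsIn (B : Set (Simplex X))) :
    h c ∈ chainsIn (nbhd d B : Set (Simplex X)) :=
  mem_chainsIn.2 fun _ ht => by
    obtain ⟨s, hs, hst⟩ := exists_single hc ht
    exact nbhd_mono (LowerSet.Iic_le.2 hs) d (hd s hst)

lemma mem_coComplement {A : Subcomplex X} {s : Simplex X} (hs : s ∉ A) : s ∈ coComplement A :=
  subset_lowerClosure hs

/-- Being within `d` stars of each other is symmetric, so a common vertex would put a vertex of
`N_{R+d}(K)` into the closure of the complement of its closed star. The summand `1` is needed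
because the closure of a complement shares faces with the subcomplex removed. -/
lemma not_mem_nbhd_of_mem_nbhd_outside {K : Subcomplex X} {d R R' : ℕ} (h : R + d + 1 ≤ R')
    {s : Simplex X} (hs : s ∈ nbhd d (outside K R')) : s ∉ nbhd R K := by
  intro hsR
  obtain ⟨v, hv⟩ := simplex_nonempty s
  have h1 : Meets (nbhd d (outside K (R + d + 1))) (nbhd R K) :=
    ⟨v, ⟨s, nbhd_mono (outside_anti K h) d hs, hv⟩, ⟨s, hsR, hv⟩⟩
  have h2 := h1.nbhd
  rw [nbhd_nbhd, outside, nbhd_succ, add_comm R d] at h2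
  exact not_meets_coComplement_closedStar h2

lemma nbhd_outside_le {K : Subcomplex X} {d R R' : ℕ} (h : R + d + 1 ≤ R') :
    nbhd d (outside K R') ≤ outside K R :=
  fun _ hs => mem_coComplement (not_mem_nbhd_of_mem_nbhd_outside h hs)

lemma apply_eq_zero_of_mem_nbhd_outside {K : Subcomplex X} {d R R' : ℕ} (h : R + d + 1 ≤ R')
    {φ : Cochains X} (hφ : φ ∈ chainsIn (nbhd d (outside K R') : Set (Simplex X)))
    {s : Simplex X} (hs : s ∈ nbhd R K) : φ s = 0 := by
  by_contra hne
  exact not_mem_nbhd_of_mem_nbhd_outside h (mem_chainsIn.1 hφ s hne) hs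

/-- Cochains vanishing on a neighbourhood of `K` are carried by the complement. -/
lemma mem_chainsIn_outside {K : Subcomplex X} {R : ℕ} {φ : Cochains X}
    (h : ∀ s ∈ nbhd R K, φ s = 0) : φ ∈ chainsIn (outside K R : Set (Simplex X)) :=
  mem_chainsIn.2 fun s hs => mem_coComplement fun hs' => hs (h s hs')

/-- A homogeneous cochain vanishing on the simplices of `A` of its degree vanishes on `A`. -/
lemma apply_eq_zero_of_degree {B : Set (Simplex X)} {i : ℤ} {φ : Cochains X}
    (hφ : φ ∈ chainsOn B i) {s : Simplex X} (h : (s.1.card : ℤ) = i + 1 → φ s = 0) : φ s = 0 := by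
  by_contra hne
  exact hne (h (mem_chainsOn.1 hφ s hne).2)

lemma chainsOn_degree {A : Set (Simplex X)} {i j : ℤ} (h : i = j) {c : Simplex X →₀ ℤ}
    (hc : c ∈ chainsOn A i) : c ∈ chainsOn A j := h ▸ hc

lemma augBoundary_mem_redCycles {A : Subcomplex X} {j : ℤ} {c : Chains X}
    (hc : c ∈ chainsOn Set.univ (j + 1)) (h : boundary X c ∈ chainsIn (A : Set (Simplex X))) :
    augBoundary X (c, 0) ∈ redCycles A j := by
  have h1 := augBoundary_mem_augChainsOn (A := ⊤) (j := j) (c := c) (by simpa using hc)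
  exact ⟨⟨mem_chainsOn_of_mem_chainsIn h1.1 h, h1.2⟩, augBoundary_augBoundary X _⟩

namespace UniformlyProperChainMap

variable {L : ℕ} {φ : ℝ≥0 → ℝ≥0} (f : UniformlyProperChainMap X' X L φ)

lemma transpose_restrict {A : Subcomplex X} (h : f.image ≤ A) (ψ : Cochains X) :
    transpose f.toLin f.locallyFinite (restrict A ψ) = transpose f.toLin f.locallyFinite ψ := by
  ext t
  rw [transpose_apply, transpose_apply, pairing_restrict (f.apply_mem_chainsIn h _)]

lemma transpose_coboundary (ψ : Cochains X) :
    transpose f.toLin f.locallyFinite (coboundary X ψ)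
      = coboundary X' (transpose f.toLin f.locallyFinite ψ) := by
  ext t
  rw [transpose_apply, pairing_coboundary, coboundary_apply, pairing_transpose, f.comm]

lemma degree_single (s : Simplex X') :
    f.toLin (Finsupp.single s 1) ∈ chainsOn Set.univ ((s.1.card : ℤ) - 1) :=
  f.degree _ _ (single_mem_chainsOn (Set.mem_univ _) (by ring))

lemma transpose_mem {A : Set (Simplex X)} {i : ℤ} {ψ : Cochains X} (hψ : ψ ∈ chainsOn A i) :
    transpose f.toLin f.locallyFinite ψ ∈ chainsOn Set.univ i :=
  transpose_mem_chainsOn (d := 0) f.locallyFinite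
    (fun s => by simpa using f.degree_single s) (by ring) hψ

end UniformlyProperChainMap

/-! ### Transposes of the coarse inverse on compactly supported cochains -/

namespace CoarseInverse

variable {L k R r S : ℕ} {φ : ℝ≥0 → ℝ≥0} {f : UniformlyProperChainMap X' X L φ}
  (G : CoarseInverse f k R r S)

lemma g_map_degree {A : Set (Simplex X)} {j : ℤ} {c : Chains X} (hc : c ∈ chainsOn A j) :
    G.g c ∈ chainsOn Set.univ j :=
  map_mem_of_mem_chainsOn G.g _ (fun s _ hs => chainsOn_degree (by linarith) (G.g_degree s)) hc

lemma H_map_degree {A : Set (Simplex X)} {j : ℤ} {c : Chains X} (hc : c ∈ chainsOn A j) :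
    G.H c ∈ chainsOn Set.univ (j + 1) :=
  map_mem_of_mem_chainsOn G.H _ (fun s _ hs => chainsOn_degree (by linarith) (G.H_degree s)) hc

lemma g_map_comm {j : ℤ} (hj : j ≤ k) {c : Chains X}
    (hc : c ∈ chainsOn (nbhd R f.image : Set (Simplex X)) j) :
    boundary X' (G.g c) = G.g (boundary X c) :=
  eq_of_mem_chainsOn (boundary X' ∘ₗ G.g) (G.g ∘ₗ boundary X)
    (fun s hs hc => G.g_comm s hs (by omega)) hc

lemma g_map_augmentation {j : ℤ} (hj : j ≤ k) {c : Chains X}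
    (hc : c ∈ chainsOn (nbhd R f.image : Set (Simplex X)) j) :
    augmentation X' (G.g c) = augmentation X c :=
  eq_of_mem_chainsOn (augmentation X' ∘ₗ G.g) (augmentation X)
    (fun s hs hc => G.g_augmentation s hs (by omega)) hc

lemma H_map_comm {j : ℤ} (hj : j ≤ k) {c : Chains X}
    (hc : c ∈ chainsOn (nbhd R f.image : Set (Simplex X)) j) :
    boundary X (G.H c) + G.H (boundary X c) = f.toLin (G.g c) - c :=
  eq_of_mem_chainsOn (boundary X ∘ₗ G.H + G.H ∘ₗ boundary X) (f.toLin ∘ₗ G.g - LinearMap.id)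
    (fun s hs hc => G.H_comm s hs (by omega)) hc

lemma H_map_augmentation (c : Chains X) : augmentation X (G.H c) = 0 := by
  have : augmentation X ∘ₗ G.H = 0 := by
    ext1 s; ext1
    exact G.H_augmentation s
  exact LinearMap.congr_fun this c

lemma H_map_mem (c : Chains X) : G.H c ∈ chainsIn (nbhd S f.image : Set (Simplex X)) :=
  map_mem_of_mem_chainsIn (A := Set.univ) G.H _ (fun s _ => G.H_mem s)
    (mem_chainsIn.2 fun _ _ => trivial)

/-- The transpose of `g`. -/
noncomputable def gT : Cochains X' →ₗ[ℤ] Cochains X := transpose G.g G.g_locallyFinite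

/-- The transpose of `H`. -/
noncomputable def HT : Cochains X →ₗ[ℤ] Cochains X := transpose G.H G.H_locallyFinite

/-- The transpose of `H'`. -/
noncomputable def HT' : Cochains X' →ₗ[ℤ] Cochains X' := transpose G.H' G.H'_locallyFinite

lemma gT_mem {A : Set (Simplex X')} {i : ℤ} {ψ : Cochains X'} (hψ : ψ ∈ chainsOn A i) :
    G.gT ψ ∈ chainsOn Set.univ i :=
  transpose_mem_chainsOn (d := 0) _ (fun s => by simpa using G.g_degree s) (by ring) hψ

lemma HT_mem {A : Set (Simplex X)} {i : ℤ} {ψ : Cochains X} (hψ : ψ ∈ chainsOn A i) :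
    G.HT ψ ∈ chainsOn Set.univ (i - 1) :=
  transpose_mem_chainsOn (d := 1) _ (fun s => by simpa using G.H_degree s) (by ring) hψ

lemma HT'_mem {A : Set (Simplex X')} {i : ℤ} {ψ : Cochains X'} (hψ : ψ ∈ chainsOn A i) :
    G.HT' ψ ∈ chainsOn Set.univ (i - 1) :=
  transpose_mem_chainsOn (d := 1) _ (fun s => by simpa using G.H'_degree s) (by ring) hψ

lemma pairing_gT (ψ : Cochains X') (c : Chains X) : pairing (G.gT ψ) c = pairing ψ (G.g c) :=
  pairing_transpose _ _ _ _

lemma pairing_HT (ψ : Cochains X) (c : Chains X) : pairing (G.HT ψ) c = pairing ψ (G.H c) :=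
  pairing_transpose _ _ _ _

lemma pairing_HT' (ψ : Cochains X') (c : Chains X') :
    pairing (G.HT' ψ) c = pairing ψ (G.H' c) := pairing_transpose _ _ _ _

/-- On the domain of `g`, a cochain `ψ` whose coboundary vanishes on the track of the homotopy and
whose pullback by `f` is the coboundary of `ξ` is a coboundary. -/
lemma apply_eq_coboundary {i : ℤ} (hi : i ≤ k) {ψ : Cochains X} {ξ : Cochains X'}
    (hψ : ∀ s ∈ nbhd S f.image, coboundary X ψ s = 0)
    (hξ : transpose f.toLin f.locallyFinite ψ = coboundary X' ξ) {s : Simplex X}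
    (hs : s ∈ nbhd R f.image) (hc : (s.1.card : ℤ) = i + 1) :
    coboundary X (G.gT ξ - G.HT ψ) s = ψ s := by
  have h1 : pairing ξ (G.g (boundary X (Finsupp.single s 1)))
      = pairing ψ (f.toLin (G.g (Finsupp.single s 1))) := by
    rw [← G.g_comm s hs (by omega), ← pairing_coboundary, ← hξ, pairing_transpose]
  have h2 : pairing ψ (boundary X (G.H (Finsupp.single s 1))) = 0 := by
    rw [← pairing_coboundary]
    exact pairing_eq_zero (G.H_mem s) hψ
  have h3 := congrArg (pairing ψ) (G.H_comm s hs (by omega))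
  rw [map_add, map_sub, h2, zero_add, pairing_single] at h3
  rw [coboundary_apply, pairing_sub_left, pairing_gT, pairing_HT, h1, h3, sub_sub_cancel]

/-- The pullback by `g` of a cocycle is a cocycle on the domain of `g`. -/
lemma coboundary_gT_apply {i : ℤ} (hi : i < k) {A : Set (Simplex X')} {β : Cochains X'}
    (hβ : β ∈ chainsOn A i) (hδ : coboundary X' β = 0) {s : Simplex X}
    (hs : s ∈ nbhd R f.image) : coboundary X (G.gT β) s = 0 := by
  refine apply_eq_zero_of_degree (coboundary_mem_chainsOn rfl (G.gT_mem hβ)) fun hc => ?_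
  rw [coboundary_apply, pairing_gT, ← G.g_comm s hs (by omega), ← pairing_coboundary, hδ]
  simp [pairing]

/-- Pulling a cocycle back by `g` and then by `f` does not change its class. -/
lemma transpose_gT {i : ℤ} (hi : i < k) {A : Set (Simplex X')} {β : Cochains X'}
    (hβ : β ∈ chainsOn A i) (hδ : coboundary X' β = 0) :
    transpose f.toLin f.locallyFinite (G.gT β) - β = coboundary X' (G.HT' β) := by
  refine cochain_eq_of_degree (Submodule.sub_mem _ (f.transpose_mem (G.gT_mem hβ))
    (chainsOn_mono (Set.subset_univ _) _ hβ))
    (coboundary_mem_chainsOn (sub_add_cancel i 1) (G.HT'_mem hβ)) fun s hs => ?_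
  have h1 := congrArg (pairing β) (G.H'_comm s (by omega))
  have h2 : pairing β (boundary X' (G.H' (Finsupp.single s 1))) = 0 := by
    rw [← pairing_coboundary, hδ]
    simp [pairing]
  rw [map_add, map_sub, h2, zero_add, pairing_single] at h1
  rw [Finsupp.sub_apply, transpose_apply, pairing_gT, coboundary_apply, pairing_HT', h1]

/-- The pullback by `g` of a cochain carried by `T` is carried by a neighbourhood of the image of
`T`, and so is its coboundary. -/
lemma coboundary_gT_mem {T : Subcomplex X'} {β : Cochains X'}
    (hβ : β ∈ chainsIn (T : Set (Simplex X'))) : coboundary X (G.gT β)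
      ∈ chainsIn (nbhd (r + 1) (imageSupport f.toLin T) : Set (Simplex X)) := by
  refine mem_chainsIn.2 fun t ht => ?_
  obtain ⟨s, hst, hs⟩ : ∃ s ≤ t, G.gT β s ≠ 0 := by
    by_contra! hcon
    refine ht ?_
    rw [coboundary_apply]
    exact pairing_eq_zero (A := {s | s ≤ t})
      (mem_chainsIn.2 fun s hs => (boundary_single t s hs).1) hcon
  obtain ⟨q, hqT, hq⟩ : ∃ q ∈ T, G.g (Finsupp.single s 1) q ≠ 0 := by
    by_contra! hcon
    refine hs ?_
    rw [gT, transpose_apply]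
    refine pairing_eq_zero (A := {q | q ∉ T}) (mem_chainsIn.2 fun q hq hqT => hq (hcon q hqT))
      fun q hq => ?_
    by_contra hne
    exact hq (mem_chainsIn.1 hβ q hne)
  obtain ⟨v, hv⟩ := simplex_nonempty s
  obtain ⟨w, hw⟩ := simplex_nonempty q
  refine mem_nbhd_succ (f.vertexMap_mem ⟨q, hqT, hw⟩) ?_ (hst hv)
  rw [X.dist_comm]
  exact G.g_dist s q hq v hv w hw

end CoarseInverse

/-! ### Kernels and images of the duality maps -/

namespace CoarsePD

variable {n N D₀ L k : ℕ} {a : ℕ → ℕ} {φ : ℝ≥0 → ℝ≥0}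

lemma alexander_mk (E : CoarsePD X n N D₀ a) {A B : Subcomplex X} (h : E.Separates A B) (i m : ℤ)
    (him : i + 1 + m = n) {c : Chains X} (hc : c ∈ relCycles A (i + 1)) :
    ∃ hz, E.alexander h i m him (connecting A i (Subquot.mk c hc))
      = Subquot.mk (restrict B (E.Pbar c)) hz :=
  ⟨_, congrArg (E.pbarMap h (i + 1) m him) (E.connectingInv_connecting A i (Subquot.mk c hc))⟩

/-- On classes given by a relative cycle the map is simply `f* Pbar`: the restriction to the
neighbourhood of `K` is invisible to `f*`, because `f` takes values in chains of `K`. -/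
lemma homologyToMap_mk (E : CoarsePD X n N D₀ a) (f : UniformlyProperChainMap X' X L φ) (i : ℤ)
    {R : ℕ} (hR : D₀ + 1 ≤ R) {c : Chains X}
    (hc : c ∈ relCycles (outside f.image R) (n - i - 1 + 1)) :
    ∃ hz, E.homologyToMap f i hR (connecting _ _ (Subquot.mk c hc))
      = Subquot.mk (transpose f.toLin f.locallyFinite (E.Pbar c)) hz := by
  obtain ⟨h1, h2⟩ := E.alexander_mk (E.separates_outside' f.image hR) (n - i - 1) i (by ring) hc
  have h3 := f.transpose_restrict (le_nbhd (R - (D₀ + 1)) f.image) (E.Pbar c)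
  obtain ⟨h4, h5⟩ : ∃ hz, f.cohomologyMap (le_nbhd (R - (D₀ + 1)) f.image) i
      (Subquot.mk (restrict (nbhd (R - (D₀ + 1)) f.image) (E.Pbar c)) h1)
      = Subquot.mk (transpose f.toLin f.locallyFinite
        (restrict (nbhd (R - (D₀ + 1)) f.image) (E.Pbar c))) hz := ⟨_, rfl⟩
  refine ⟨h3 ▸ h4, ?_⟩
  rw [homologyToMap, AddMonoidHom.comp_apply, h2, h5]
  simp only [h3]

/-- Near `K` the cochain `Pbar c` is a cocycle cohomologous to `g* f* Pbar c`, hence a coboundary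
`δθ` there. Then `c = P (Pbar c - δθ) + ∂(P θ) - ∂(Φ c) - Φ (∂c)`, and the first and last terms are
carried by `Y_R`. -/
theorem redIncl_eq_zero_of_homologyToMap (E : CoarsePD X n N D₀ a)
    {f : UniformlyProperChainMap X' X L φ} {R R' r S : ℕ}
    (G : CoarseInverse f k (R + D₀ + 1) r S) {i : ℤ} (hi : i ≤ k) (hD : D₀ + 1 ≤ R')
    (hS : S + D₀ + 1 ≤ R') (hRR : R + D₀ + 1 ≤ R') (hle : R ≤ R')
    (x : RedHomology (outside f.image R') (n - i - 1)) (hx : E.homologyToMap f i hD x = 0) :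
    redIncl (outside_anti f.image hle) _ x = 0 := by
  obtain ⟨y, rfl⟩ := (connecting_bijective E.acyclic _ _).2 x
  obtain ⟨c, hc, rfl⟩ := Subquot.exists_mk y
  obtain ⟨hz, hmk⟩ := E.homologyToMap_mk f i hD hc
  rw [hmk] at hx
  obtain ⟨ξ, hξ, hξc⟩ := (Submodule.Quotient.mk_eq_zero _).1 hx
  have hξc' : transpose f.toLin f.locallyFinite (E.Pbar c) = coboundary X' ξ :=
    (hξc.symm.trans (restrict_top _))
  have hPc : E.Pbar c ∈ chainsOn Set.univ i :=
    chainsOn_degree (by ring) (E.Pbar_degree _ c hc.1)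
  -- The coboundary of `Pbar c` has to vanish on the entire track of `H`, which forces `R'` to
  -- exceed `S + D₀`.
  have hδ : ∀ s ∈ nbhd S f.image, coboundary X (E.Pbar c) s = 0 := fun s hs => by
    rw [← E.Pbar_comm]
    exact apply_eq_zero_of_mem_nbhd_outside hS (E.Pbar_displacement.apply_mem hc.2) hs
  set θ := G.gT ξ - G.HT (E.Pbar c)
  have hθ : θ ∈ chainsOn Set.univ (i - 1) := Submodule.sub_mem _ (G.gT_mem hξ) (G.HT_mem hPc)
  have hη : E.Pbar c - coboundary X θ ∈ chainsOn Set.univ i :=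
    Submodule.sub_mem _ hPc (coboundary_mem_chainsOn (sub_add_cancel i 1) hθ)
  have hηout : E.Pbar c - coboundary X θ
      ∈ chainsIn (outside f.image (R + D₀ + 1) : Set (Simplex X)) :=
    mem_chainsIn_outside fun s hs => apply_eq_zero_of_degree hη fun hcard => by
      rw [Finsupp.sub_apply, G.apply_eq_coboundary hi hδ hξc' hs hcard, sub_self]
  -- The cochain was killed on a neighbourhood larger than `N_R(K)` by `D₀ + 1` exactly so that `P`
  -- cannot bring it back into `N_R(K)`.
  have hPη : E.P (E.Pbar c - coboundary X θ)
      ∈ chainsOn (outside f.image R : Set (Simplex X)) (n - i - 1 + 1) :=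
    mem_chainsOn_of_mem_chainsIn (chainsOn_degree (by ring) (E.P_degree i _ hη))
      (chainsIn_mono (nbhd_outside_le le_rfl) (E.P_displacement.apply_mem hηout))
  have hΦ : E.Φ (boundary X c)
      ∈ chainsOn (outside f.image R : Set (Simplex X)) (n - i - 1 + 1) := by
    have h1 := boundary_mem_chainsOn (A := ⊤) (j := n - i - 1) (c := c) (by simpa using hc.1)
    exact mem_chainsOn_of_mem_chainsIn
      (E.Φ_degree _ _ (chainsOn_mono (Set.subset_univ _) _ h1))
      (chainsIn_mono (nbhd_outside_le hRR) (E.Φ_displacement.apply_mem hc.2))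
  have hc' : c ∈ relCycles (outside f.image R) (n - i - 1 + 1) :=
    ⟨hc.1, chainsIn_mono (outside_anti f.image hle) hc.2⟩
  have hzero : (Subquot.mk c hc' : RelHomology (outside f.image R) (n - i - 1 + 1)) = 0 := by
    refine (Submodule.Quotient.mk_eq_zero _).2 (Submodule.mem_sup.2
      ⟨boundary X (E.P θ - E.Φ c), ⟨_, Submodule.sub_mem _
        (chainsOn_degree (by ring) (E.P_degree _ _ hθ)) (E.Φ_degree _ _ hc.1), rfl⟩,
      _, Submodule.sub_mem _ hPη hΦ, ?_⟩)
    have h1 := E.homotopy c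
    change boundary X (E.P θ - E.Φ c) + (E.P (E.Pbar c - coboundary X θ) - E.Φ (boundary X c)) = c
    rw [map_sub (boundary X), map_sub E.P (E.Pbar c), E.P_comm, sub_eq_iff_eq_add.1 h1]
    abel
  change connecting (outside f.image R) (n - i - 1) (Subquot.mk c hc') = 0
  rw [hzero, map_zero]

/-- The preimage is the boundary of `P (g* β)`. It avoids `N_R(K)` because `g* β` is a cocycle near
`K`, which uses `g` on `(i+1)`-simplices and hence `i < k`; it is near the image of `T` because `g`
has bounded displacement. -/
theorem mem_range_homologyToMap (E : CoarsePD X n N D₀ a)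
    {f : UniformlyProperChainMap X' X L φ} {R r S : ℕ}
    (G : CoarseInverse f k (R + D₀ + 1) r S) {i : ℤ} (hi : i < k) (T : Subcomplex X')
    {α : CptCohomology (⊤ : Subcomplex X') i} (hα : α ∈ (relToAbs (coComplement T) i).range)
    (hR : D₀ + 1 ≤ R) :
    α ∈ ((E.homologyToMap f i hR).comp
      (redIncl (inf_le_left : outside f.image R ⊓ nbhd (D₀ + (r + 1)) (imageSupport f.toLin T)
        ≤ outside f.image R) (n - i - 1))).range := by
  obtain ⟨x, rfl⟩ := hα
  obtain ⟨β, hβ, rfl⟩ := Subquot.exists_mk x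
  have hδ : coboundary X' β = 0 := hβ.2
  have hβT : β ∈ chainsIn (T : Set (Simplex X')) := mem_chainsIn.2 fun s hs => by
    by_contra hsT
    exact (mem_chainsOn.1 hβ.1 s hs).1 (mem_coComplement hsT)
  set η := G.gT β
  have hη : η ∈ chainsOn Set.univ i := G.gT_mem hβ.1
  have hδη : coboundary X η ∈ chainsIn (outside f.image (R + D₀ + 1) : Set (Simplex X)) :=
    mem_chainsIn_outside fun s hs => G.coboundary_gT_apply hi hβ.1 hδ hs
  have hc : E.P η ∈ chainsOn Set.univ (n - i - 1 + 1) :=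
    chainsOn_degree (by ring) (E.P_degree i η hη)
  have hbd : boundary X (E.P η) ∈ chainsIn (outside f.image R : Set (Simplex X)) := by
    rw [← E.P_comm]
    exact chainsIn_mono (nbhd_outside_le le_rfl) (E.P_displacement.apply_mem hδη)
  have hbd' : boundary X (E.P η)
      ∈ chainsIn (nbhd (D₀ + (r + 1)) (imageSupport f.toLin T) : Set (Simplex X)) := by
    rw [← E.P_comm, ← nbhd_nbhd]
    exact E.P_displacement.apply_mem (G.coboundary_gT_mem hβT)
  -- The augmented boundary also covers `i = n`, where `P η` has degree `0` and the class lies in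
  -- reduced homology of degree `-1`.
  refine ⟨Subquot.mk (augBoundary X (E.P η, 0)) (augBoundary_mem_redCycles hc
    (mem_chainsIn.2 fun s hs => ⟨mem_chainsIn.1 hbd s hs, mem_chainsIn.1 hbd' s hs⟩)), ?_⟩
  obtain ⟨hz, hmk⟩ := E.homologyToMap_mk f i hR (c := E.P η) ⟨hc, hbd⟩
  refine hmk.trans (Subquot.mk_eq_mk.2 ?_)
  change transpose f.toLin f.locallyFinite (E.Pbar (E.P η)) - β ∈ _
  -- The error term `Φbar (δη)` is carried away from `K`, so `f*` kills it.
  have h1 : transpose f.toLin f.locallyFinite (E.Φbar (coboundary X η)) = 0 := by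
    ext t
    rw [transpose_apply]
    exact pairing_eq_zero (f.apply_mem_chainsIn le_rfl _) fun s hs =>
      apply_eq_zero_of_mem_nbhd_outside le_rfl (E.Φbar_displacement.apply_mem hδη)
        (le_nbhd R f.image hs)
  have h2 := congrArg (transpose f.toLin f.locallyFinite) (E.homotopy_bar η)
  rw [map_sub, map_add, h1, add_zero, f.transpose_coboundary] at h2
  have h3 := G.transpose_gT hi hβ.1 hδ
  -- Two homotopies contribute to the primitive: `Φbar` between `Pbar P` and the identity, and `H'`
  -- between `g ∘ f` and the identity.
  refine ⟨transpose f.toLin f.locallyFinite (E.Φbar η) + G.HT' β, ?_, ?_⟩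
  · simpa using Submodule.add_mem _ (f.transpose_mem (E.Φbar_degree i η hη)) (G.HT'_mem hβ.1)
  · change restrict ⊤ (coboundary X' _) = _
    rw [restrict_top, map_add, ← h2, ← h3, sub_add_sub_cancel]

/-- Extended by zero, `ψ` has coboundary carried by `N_R(K)`, so `∂(P ψ) = P (δψ)` is a cycle near
`K`. Its image under `g` is the class sought: `H` joins `f g ∂(P ψ)` to `∂(P ψ)` inside `N_S(K)`,
and `Pbar P ψ` differs from `ψ` on `Y_{R'}` by a coboundary. -/
theorem exists_mapToCohomology_eq (E : CoarsePD X n N D₀ a)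
    {f : UniformlyProperChainMap X' X L φ} {R R' r S : ℕ}
    (G : CoarseInverse f k (D₀ + R) r S) {i : ℤ} (hi : i ≤ k) (hS : D₀ + R ≤ S)
    (hS' : S + (D₀ + 1) ≤ R') (hle : R ≤ R')
    (y : CptCohomology (outside f.image R) (n - i - 1)) :
    ∃ x, cohRestrict (outside_anti f.image hS') _ (E.mapToCohomology f i S x)
      = cohRestrict (outside_anti f.image hle) _ y := by
  obtain ⟨ψ, hψ, rfl⟩ := Subquot.exists_mk y
  have hψ' : ψ ∈ chainsOn Set.univ (n - i - 1) := chainsOn_mono (Set.subset_univ _) _ hψ.1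
  have hδ : coboundary X ψ ∈ chainsIn (nbhd R f.image : Set (Simplex X)) := by
    have h0 : restrict (outside f.image R) (coboundary X ψ) = 0 := hψ.2
    refine mem_chainsIn.2 fun s hs => ?_
    by_contra hsR
    have h1 := DFunLike.congr_fun h0 s
    rw [restrict_apply, if_pos (show s ∈ outside f.image R from mem_coComplement hsR)] at h1
    exact hs h1
  set c := E.P ψ with hcdef
  have hc : c ∈ chainsOn Set.univ (i + 1) :=
    chainsOn_degree (by ring) (E.P_degree _ ψ hψ')
  have hbd : boundary X c ∈ chainsIn (nbhd (D₀ + R) f.image : Set (Simplex X)) := by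
    rw [← E.P_comm, ← nbhd_nbhd]
    exact E.P_displacement.apply_mem hδ
  have hbdS := chainsIn_mono (nbhd_mono_left hS f.image) hbd
  have hbdeg : boundary X c ∈ chainsOn (nbhd (D₀ + R) f.image : Set (Simplex X)) i :=
    mem_chainsOn_of_mem_chainsIn
      (boundary_mem_chainsOn (A := ⊤) (j := i) (c := c) (by simpa using hc)) hbd
  have hz := augBoundary_mem_redCycles hc hbdS
  -- The second component carries the degree `-1` part, present only when `i = -1`.
  have hx : (G.g (boundary X c), augmentation X c) ∈ redCycles (⊤ : Subcomplex X') i := by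
    refine ⟨⟨by simpa using G.g_map_degree hbdeg, hz.1.2⟩, ?_⟩
    refine Prod.ext ?_ ?_
    · change boundary X' (G.g (boundary X c)) = 0
      rw [G.g_map_comm hi hbdeg, boundary_boundary, map_zero]
    · change augmentation X' (G.g (boundary X c)) = 0
      rw [G.g_map_augmentation hi hbdeg, augmentation_boundary]
  refine ⟨Subquot.mk _ hx, ?_⟩
  have hclass : f.homologyMap (le_nbhd S f.image) i (Subquot.mk _ hx)
      = connecting (nbhd S f.image) i (Subquot.mk c ⟨hc, hbdS⟩) := by
    refine Subquot.mk_eq_mk.2 ⟨(G.H (boundary X c), 0), ⟨mem_chainsOn_of_mem_chainsIn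
      (G.H_map_degree hbdeg) (G.H_map_mem _), Submodule.zero_mem _⟩, ?_⟩
    refine Prod.ext ?_ ?_
    · change boundary X (G.H (boundary X c)) = f.toLin (G.g (boundary X c)) - boundary X c
      rw [← G.H_map_comm hi hbdeg, boundary_boundary, map_zero, add_zero]
    · change augmentation X (G.H (boundary X c)) = augmentation X c - augmentation X c
      rw [G.H_map_augmentation, sub_self]
  obtain ⟨h1, h2⟩ := E.alexander_mk (E.separates_nbhd f.image S) i (n - i - 1) (by ring)
    (c := c) ⟨hc, hbdS⟩
  have h3 : E.mapToCohomology f i S (Subquot.mk _ hx)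
      = Subquot.mk (restrict (outside f.image (S + (D₀ + 1))) (E.Pbar c)) h1 :=
    (congrArg _ hclass).trans h2
  rw [h3]
  refine Subquot.mk_eq_mk.2 ?_
  change restrict (outside f.image R') (restrict (outside f.image (S + (D₀ + 1))) (E.Pbar c))
    - restrict (outside f.image R') ψ ∈ _
  rw [restrict_restrict (outside_anti f.image hS'), ← map_sub, hcdef, E.homotopy_bar ψ, map_add]
  have h4 : restrict (outside f.image R') (E.Φbar (coboundary X ψ)) = 0 := by
    ext s
    rw [restrict_apply]
    split_ifs with hs
    · by_contra hne
      have h5 := mem_chainsIn.1 (E.Φbar_displacement.apply_mem hδ) s hne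
      rw [nbhd_nbhd] at h5
      -- No thickening of `Y_{R'}` is needed: the error term is carried by `N_{D₀+R}(K)`, and `R'`
      -- exceeds `D₀ + R` because `D₀ + R ≤ S`.
      exact not_mem_nbhd_of_mem_nbhd_outside (d := 0) (R := D₀ + R) (by omega) hs h5
    · rfl
  refine ⟨restrict (outside f.image R') (E.Φbar ψ),
    restrict_mem_chainsOn (E.Φbar_degree _ ψ hψ'), ?_⟩
  rw [h4, add_zero]
  exact restrict_coboundary_restrict _

end CoarsePD

/-- The reduced homology of a uniformly acyclic complex vanishes. -/
lemma redHomology_eq_zero {M j : ℤ} {a : ℕ → ℕ} (hX : X.UniformlyAcyclicUpTo M a) (hj : j ≤ M)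
    (x : RedHomology (⊤ : Subcomplex X) j) : x = 0 := by
  obtain ⟨z, hz, rfl⟩ := Subquot.exists_mk x
  obtain ⟨v⟩ := X.connected.nonempty
  obtain ⟨r, hr⟩ := ((z.1.support.finite_toSet.biUnion fun s _ => s.1.finite_toSet).image
    (X.dist v)).bddAbove
  obtain ⟨e, he, hez, -⟩ := exists_filling hX hj hz v r (mem_chainsIn.2 fun s hs w hw =>
    hr ⟨w, Set.mem_biUnion (Finset.mem_coe.2 (Finsupp.mem_support_iff.2 hs)) hw, rfl⟩)
  exact (Submodule.Quotient.mk_eq_zero _).2 ⟨(e, 0), inl_mem_augChainsOn_top he, hez⟩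

/-- The reduced homology in degree `-1` of a nonempty complex vanishes. -/
lemma redHomology_neg_one_eq_zero {A : Subcomplex X} {s : Simplex X} (hs : s ∈ A)
    (x : RedHomology A (-1)) : x = 0 := by
  obtain ⟨z, hz, rfl⟩ := Subquot.exists_mk x
  obtain ⟨v, hv⟩ := simplex_nonempty s
  have hc : z.1 = 0 := by
    ext t
    by_contra ht
    have h1 := (mem_chainsOn.1 hz.1.1 t ht).2
    have h2 := Finset.card_pos.2 (simplex_nonempty t)
    omega
  refine (Submodule.Quotient.mk_eq_zero _).2 ⟨(z.2 • Finsupp.single (X.vertex v) 1, 0),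
    ⟨Submodule.smul_mem _ _ (single_mem_chainsOn
      (A.lower (Finset.singleton_subset_iff.2 hv : X.vertex v ≤ s) hs)
      (by simp [MetricComplex.vertex])), Submodule.zero_mem _⟩, ?_⟩
  rw [augBoundary_vertex]
  exact Prod.ext hc.symm rfl

/-- Every compactly supported class comes from the pair with empty subcomplex. -/
lemma mem_range_relToAbs_top {i : ℤ} (α : CptCohomology (⊤ : Subcomplex X) i) :
    α ∈ (relToAbs (coComplement (⊤ : Subcomplex X)) i).range := by
  obtain ⟨β, hβ, rfl⟩ := Subquot.exists_mk α
  have hδ : coboundary X β = 0 := (restrict_top _).symm.trans hβ.2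
  refine ⟨Subquot.mk β ⟨mem_chainsOn.2 fun s hs => ⟨?_, (mem_chainsOn.1 hβ.1 s hs).2⟩, hδ⟩, rfl⟩
  rintro ⟨t, ht, -⟩
  exact ht LowerSet.mem_top

end CoarseAlexander

/-! ### Uniform constants and the four assertions -/

theorem mainTheorem8 (N N' D₀ L : ℕ) (a a' : ℕ → ℕ) (φ : ℝ≥0 → ℝ≥0) :
    ∃ ω : ℕ → ℕ,
      ∀ {V : Type u} {V' : Type v} [LinearOrder V] [LinearOrder V'] (n k : ℕ)
        (X : MetricComplex V) (E : CoarsePD X n N D₀ a)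
        (X' : MetricComplex V') (_ : X'.BoundedGeometry N')
        (_ : X'.UniformlyAcyclicUpTo ((k : ℤ) - 1) a')
        (f : UniformlyProperChainMap X' X L φ),
        (∀ i : ℤ, i < k → (E.homologyMorphism f i).IsApproxIso ω ω) ∧
        (E.homologyMorphism f k).IsApproxMono ω ∧
        (∀ i : ℤ, i < k → (E.cohomologyMorphism f i).IsApproxIso ω ω) ∧
        (E.cohomologyMorphism f k).IsApproxEpi ω ∧
        (∃ ζ : ℕ → ℕ, ∀ i : ℤ, i < k → ∀ (S : Subcomplex X')
          (α : CptCohomology (⊤ : Subcomplex X') i), α ∈ (relToAbs (coComplement S) i).range →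
          ∀ (R : ℕ) (hR : D₀ + 1 ≤ R),
            α ∈ ((E.homologyToMap f i hR).comp
              (redIncl (inf_le_left : outside f.image R ⊓ nbhd (ζ R) (imageSupport f.toLin S)
                ≤ outside f.image R) (n - i - 1))).range) ∧
        (k = n + 1 → (∀ R : ℕ, nbhd R f.image ≠ ⊤) →
          ∀ α : CptCohomology (⊤ : Subcomplex X') n, α = 0) := by
  set T : ℕ → ℕ := trackRadius N L a a' φ with hT
  have hTle : ∀ R, R ≤ T R := fun R => by
    rw [hT, trackRadius]
    omega
  -- The first term serves the kernel argument, which uses a coarse inverse on `N_{R+D₀+1}(K)`; the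
  -- second serves the direct system, where it is needed on `N_{D₀+R}(K)`. In both cases `D₀ + 1` is
  -- added to leave the track of `H`.
  refine ⟨fun R => max (T (R + D₀ + 1)) (T (D₀ + R)) + (D₀ + 1), ?_⟩
  intro V V' _ _ n k X E X' _ hX' f
  have hG : ∀ R, Nonempty (CoarseInverse f k R (returnRadius N L a' φ R) (T R)) :=
    nonempty_coarseInverse E.boundedGeometry E.acyclic hX' f
  have hω : ∀ R, R + D₀ + 1 ≤ max (T (R + D₀ + 1)) (T (D₀ + R)) := fun R =>
    (hTle _).trans (le_max_left _ _)
  have hωle : ∀ R, R ≤ max (T (R + D₀ + 1)) (T (D₀ + R)) + (D₀ + 1) := fun R => by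
    have := hω R
    omega
  have hmono : ∀ i : ℤ, i ≤ k → (E.homologyMorphism f i).IsApproxMono
      (fun R => max (T (R + D₀ + 1)) (T (D₀ + R)) + (D₀ + 1)) := by
    intro i hi R
    obtain ⟨G⟩ := hG (R + D₀ + 1)
    have h1 := hω R
    refine ⟨Nat.le_add_left _ _, hωle R, fun x hx => ?_⟩
    exact E.redIncl_eq_zero_of_homologyToMap G hi (Nat.le_add_left _ _)
      (Nat.add_le_add_right (le_max_left _ _) (D₀ + 1)) (by omega) (by omega) x hx
  have hepi : ∀ i : ℤ, i ≤ k → (E.cohomologyMorphism f i).IsApproxEpi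
      (fun R => max (T (R + D₀ + 1)) (T (D₀ + R)) + (D₀ + 1)) := by
    intro i hi R
    obtain ⟨G⟩ := hG (D₀ + R)
    refine ⟨hωle R, fun y => ?_⟩
    have hS : T (D₀ + R) + (D₀ + 1) ≤ max (T (R + D₀ + 1)) (T (D₀ + R)) + (D₀ + 1) :=
      Nat.add_le_add_right (le_max_right _ _) _
    obtain ⟨x, hx⟩ := E.exists_mapToCohomology_eq G hi (hTle _) hS (hωle R) y
    exact ⟨⟨T (D₀ + R), trivial⟩, hS, x, hx⟩
  have hrange : ∀ i : ℤ, i < k → ∀ (S : Subcomplex X')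
      (α : CptCohomology (⊤ : Subcomplex X') i), α ∈ (relToAbs (coComplement S) i).range →
      ∀ (R : ℕ) (hR : D₀ + 1 ≤ R), α ∈ ((E.homologyToMap f i hR).comp
        (redIncl (inf_le_left : outside f.image R ⊓ nbhd
          (D₀ + (returnRadius N L a' φ (R + D₀ + 1) + 1)) (imageSupport f.toLin S)
          ≤ outside f.image R) (n - i - 1))).range := by
    intro i hi S α hα R hR
    obtain ⟨G⟩ := hG (R + D₀ + 1)
    exact E.mem_range_homologyToMap G hi S hα hR
  have hsurj : ∀ i : ℤ, i < k → ∀ (R : ℕ) (hR : D₀ + 1 ≤ R)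
      (α : CptCohomology (⊤ : Subcomplex X') i), ∃ x, E.homologyToMap f i hR x = α := by
    -- Taking the subcomplex to be all of `X'` turns the support statement into surjectivity at
    -- every level `R ≥ D₀ + 1`.
    intro i hi R hR α
    obtain ⟨x, hx⟩ := hrange i hi ⊤ α (mem_range_relToAbs_top α) R hR
    exact ⟨_, hx⟩
  refine ⟨fun i hi => ⟨hmono i hi.le, fun R => ?_⟩, hmono k le_rfl,
    fun i hi => ⟨fun R => ?_, hepi i hi.le⟩, hepi k le_rfl,
    ⟨fun R => D₀ + (returnRadius N L a' φ (R + D₀ + 1) + 1), hrange⟩, fun hk hne α => ?_⟩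
  · refine ⟨hωle R, fun y => ?_⟩
    have hR : D₀ + 1 ≤ R + (D₀ + 1) := Nat.le_add_left _ _
    obtain ⟨x, hx⟩ := hsurj i hi (R + (D₀ + 1)) hR y
    exact ⟨⟨R + (D₀ + 1), hR⟩, Nat.le_sub_of_add_le le_rfl, x, hx⟩
  -- Since `i ≤ k - 1`, the reduced homology of `X'` is zero and there is no kernel to control.
  · exact ⟨hωle R.1, fun x _ => redHomology_eq_zero hX' (by omega) x⟩
  · obtain ⟨x, rfl⟩ := hsurj n (by omega) (D₀ + 1) le_rfl α
    obtain ⟨s, hs⟩ : ∃ s : Simplex X, s ∉ nbhd (D₀ + 1) f.image := by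
      by_contra! hcon
      exact hne (D₀ + 1) (top_le_iff.1 fun s _ => hcon s)
    -- The degree is generalized because `n - n - 1` equals `-1` only propositionally. The complex
    -- `Y_D` is nonempty since `N_D(K)` omits a simplex.
    have hx : ∀ j : ℤ, j = -1 → ∀ x : RedHomology (outside f.image (D₀ + 1)) j, x = 0 := by
      rintro _ rfl x
      exact redHomology_neg_one_eq_zero (s := s) (mem_coComplement hs) x
    rw [hx _ (by ring) x, map_zero]
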